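/- Let $n>1$ and let $(M,f,\xi_1,\xi_2,\eta_1,\eta_2,g)$ be a $(2n+2)$-dimensional metric $f$-manifold with two structure vector fields: $(M,g)$ is a smooth Riemannian manifold, $f$ is a $(1,1)$-tensor field of rank $2n$ with $f^3+f=0$, and the vector fields $\xi_\alpha$ and $1$-forms $\eta_\alpha$ satisfy $\eta_\alpha(\xi_\beta)=\delta_{\alpha\beta}$, $f\xi_\alpha=0$, $\eta_\alpha\circ f=0$, $f^2=-I+\sum_\alpha\eta_\alpha\otimes\xi_\alpha$ and $g(fX,fY)=g(X,Y)-\sum_\alpha\eta_\alpha(X)\eta_\alpha(Y)$. Suppose that $M$ is a generalized $S$-space-form, i.e. there are smooth functions $F_1,\dots,F_7$ on $M$ such that the curvature tensor $R(X,Y)Z=\nabla_X\nabla_YZ-\nabla_Y\nabla_XZ-\nabla_{[X,Y]}Z$ of $g$ satisfies, for all vector fields $X,Y,Z$, $$\begin{aligned} R(X,Y)Z={}&F_1\{g(Y,Z)X-g(X,Z)Y\}+F_2\{g(X,fZ)fY-g(Y,fZ)fX+2g(X,fY)fZ\}\\ &+F_3\{\eta_1(X)\eta_1(Z)Y-\eta_1(Y)\eta_1(Z)X+g(X,Z)\eta_1(Y)\xi_1-g(Y,Z)\eta_1(X)\xi_1\}\\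 &+F_4\{\eta_2(X)\eta_2(Z)Y-\eta_2(Y)\eta_2(Z)X+g(X,Z)\eta_2(Y)\xi_2-g(Y,Z)\eta_2(X)\xi_2\}\\ &+F_5\{\eta_1(X)\eta_2(Z)Y-\eta_1(Y)\eta_2(Z)X+g(X,Z)\eta_1(Y)\xi_2-g(Y,Z)\eta_1(X)\xi_2\}\\ &+F_6\{\eta_2(X)\eta_1(Z)Y-\eta_2(Y)\eta_1(Z)X+g(X,Z)\eta_2(Y)\xi_1-g(Y,Z)\eta_2(X)\xi_1\}\\ &+F_7\{\eta_1(X)\eta_2(Y)\eta_2(Z)\xi_1-\eta_2(X)\eta_1(Y)\eta_2(Z)\xi_1+\eta_2(X)\eta_1(Y)\eta_1(Z)\xi_2-\eta_1(X)\eta_2(Y)\eta_1(Z)\xi_2\}. \end{aligned}$$ Let $\kappa,\mu\in\mathbb R$ and suppose that $M$ is an $f$-$(\kappa,\mu)$ manifold, i.e. it is a metric $f$-contact manifold ($g(X,fY)=d\eta_\alpha(X,Y)$ for $\alpha=1,2$, where $2\,d\eta(X,Y)=X\eta(Y)-Y\eta(X)-\eta([X,Y])$) that satisfies the $(\kappa,\mu)$-nullity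 condition $$R(X,Y)\xi_\alpha=\kappa\big(\overline\eta(X)f^2Y-\overline\eta(Y)f^2X\big)+\mu\big(\overline\eta(Y)h_\alpha X-\overline\eta(X)h_\alpha Y\big),\qquad \alpha=1,2,$$ where $\overline\eta=\eta_1+\eta_2$ and $h_\alpha=\frac12L_{\xi_\alpha}f$. Call $M$ an $S$-manifold if it is metric $f$-contact and normal, i.e. $[f,f]+2\sum_\alpha\xi_\alpha\otimes d\eta_\alpha=0$, where $[f,f]$ is the Nijenhuis tensor of $f$. The $f$-sectional curvature is the sectional curvature $K(X,fX)$, for unit tangent vectors $X$ orthogonal to $\xi_1,\xi_2$. An $f$-$(\kappa,\mu)$-space-form (respectively, $S$-space-form) is an $f$-$(\kappa,\mu)$ manifold (respectively, $S$-manifold) whose $f$-sectional curvature is constant on the whole manifold. Then $M$ is an $f$-$(\kappa,\mu)$-space-form if and only if either $M$ is an $S$-space-form, or $\kappa=-1$ and $\mu=0$. -/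

import Mathlib

open Bundle Manifold VectorField
open scoped ContDiff

namespace FGeom

noncomputable section

section LeviCivita

/-- Smooth Riemannian metrics on `M`. -/
abbrev RiemMetric (E : Type*) [NormedAddCommGroup E] [NormedSpace ℝ E]
    (M : Type*) [TopologicalSpace M] [ChartedSpace E M] [IsManifold 𝓘(ℝ, E) ∞ M] :=
  ContMDiffRiemannianMetric 𝓘(ℝ, E) ∞ E (fun x : M ↦ TangentSpace 𝓘(ℝ, E) x)

/-- Vector fields on `M` (not necessarily smooth). -/
abbrev VField (E : Type*) [NormedAddCommGroup E] [NormedSpace ℝ E]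
    (M : Type*) [TopologicalSpace M] [ChartedSpace E M] :=
  Π x : M, TangentSpace 𝓘(ℝ, E) x

variable {E : Type*} [NormedAddCommGroup E] [NormedSpace ℝ E]
  {M : Type*} [TopologicalSpace M] [ChartedSpace E M] [IsManifold 𝓘(ℝ, E) ∞ M]
  (g : RiemMetric E M)

/-- The function `g(X, Y)`. -/
def pair (X Y : VField E M) (x : M) : ℝ := g.inner x (X x) (Y x)

/-- The Lie bracket `[X, Y]`. -/
def brk (X Y : VField E M) : VField E M := mlieBracket 𝓘(ℝ, E) X Y

/-- The right-hand side of the Koszul formula, that is, `2 g(∇_X Y, Z)`. -/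
def koszul (X Y Z : VField E M) (x : M) : ℝ :=
  d% (pair g Y Z) x (X x) + d% (pair g X Z) x (Y x) - d% (pair g X Y) x (Z x)
    + pair g (brk X Y) Z x - pair g (brk X Z) Y x - pair g (brk Y Z) X x

lemma pair_mdiff {X Y : VField E M} {x : M} (hX : MDiffAt (T% X) x) (hY : MDiffAt (T% Y) x) :
    MDiffAt (pair g X Y) x := by
  have : MDifferentiableAt 𝓘(ℝ, E) (𝓘(ℝ, E).prod 𝓘(ℝ))
      (fun m ↦ TotalSpace.mk' ℝ (E := Bundle.Trivial M ℝ) m (g.inner m (X m) (Y m))) x := by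
    apply MDifferentiableAt.clm_bundle_apply₂ (F₁ := E) (F₂ := E)
    · exact (g.contMDiff x).mdifferentiableAt (by simp)
    · exact hX
    · exact hY
  simp only [mdifferentiableAt_totalSpace] at this
  exact this.2

lemma pair_comm (X Y : VField E M) : pair g X Y = pair g Y X := by
  ext x; exact g.symm x _ _

lemma pair_smul_left (f : M → ℝ) (X Y : VField E M) : pair g (f • X) Y = f * pair g X Y := by
  ext x; simp [pair]

lemma pair_smul_right (f : M → ℝ) (X Y : VField E M) : pair g X (f • Y) = f * pair g X Y := by
  ext x; simp [pair]

lemma pair_add_left (X X' Y : VField E M) : pair g (X + X') Y = pair g X Y + pair g X' Y := by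
  ext x; simp [pair]

lemma pair_add_right (X Y Y' : VField E M) : pair g X (Y + Y') = pair g X Y + pair g X Y' := by
  ext x; simp [pair]

variable [FiniteDimensional ℝ E]

lemma koszul_tensorial_left {Y Z : VField E M} {x : M}
    (hY : MDiffAt (T% Y) x) (hZ : MDiffAt (T% Z) x) :
    TensorialAt 𝓘(ℝ, E) E (fun X ↦ koszul g X Y Z x) x where
  smul {f X} hf hX := by
    have := FiniteDimensional.complete ℝ E
    have h1 := mvfderiv_mul hf (pair_mdiff g hX hZ)
    have h2 := mvfderiv_mul hf (pair_mdiff g hX hY)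
    have b1 := mlieBracket_smul_left (W := Y) hf hX
    have b2 := mlieBracket_smul_left (W := Z) hf hX
    simp only [koszul, pair_smul_left, pair_smul_right, h1, h2]
    simp [pair, brk, b1, b2, g.symm x (X x)]
    ring
  add {X X'} hX hX' := by
    have := FiniteDimensional.complete ℝ E
    have h1 := mvfderiv_add (pair_mdiff g hX hZ) (pair_mdiff g hX' hZ)
    have h2 := mvfderiv_add (pair_mdiff g hX hY) (pair_mdiff g hX' hY)
    have b1 := mlieBracket_add_left (W := Y) hX hX'
    have b2 := mlieBracket_add_left (W := Z) hX hX'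
    simp only [koszul, pair_add_left, pair_add_right, h1, h2]
    simp [pair, brk, b1, b2]
    ring

lemma koszul_tensorial_right {X Y : VField E M} {x : M}
    (hX : MDiffAt (T% X) x) (hY : MDiffAt (T% Y) x) :
    TensorialAt 𝓘(ℝ, E) E (fun Z ↦ koszul g X Y Z x) x where
  smul {f Z} hf hZ := by
    have := FiniteDimensional.complete ℝ E
    have h1 := mvfderiv_mul hf (pair_mdiff g hY hZ)
    have h2 := mvfderiv_mul hf (pair_mdiff g hX hZ)
    have b1 := mlieBracket_smul_right (V := X) hf hZ
    have b2 := mlieBracket_smul_right (V := Y) hf hZ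
    simp only [koszul, pair_smul_right, h1, h2]
    simp [pair, brk, b1, b2, g.symm x (Z x)]
    ring
  add {Z Z'} hZ hZ' := by
    have := FiniteDimensional.complete ℝ E
    have h1 := mvfderiv_add (pair_mdiff g hY hZ) (pair_mdiff g hY hZ')
    have h2 := mvfderiv_add (pair_mdiff g hX hZ) (pair_mdiff g hX hZ')
    have b1 := mlieBracket_add_right (V := X) hZ hZ'
    have b2 := mlieBracket_add_right (V := Y) hZ hZ'
    simp only [koszul, pair_add_right, h1, h2]
    simp [pair, brk, b1, b2]
    ring


/-- The musical isomorphism `v ↦ g(v, ·)` from `T_xM` to its dual. -/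
def flat (x : M) : TangentSpace 𝓘(ℝ, E) x ≃ₗ[ℝ] Module.Dual ℝ (TangentSpace 𝓘(ℝ, E) x) :=
  have : FiniteDimensional ℝ (TangentSpace 𝓘(ℝ, E) x) := inferInstanceAs (FiniteDimensional ℝ E)
  LinearMap.linearEquivOfInjective
    { toFun := fun v ↦ (g.inner x v).toLinearMap
      map_add' := fun v w ↦ by ext; simp
      map_smul' := fun c v ↦ by ext; simp }
    (by
      refine (injective_iff_map_eq_zero _).2 fun v hv ↦ ?_
      by_contra h
      exact (g.pos x v h).ne' (LinearMap.congr_fun hv v))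
    Subspace.dual_finrank_eq.symm

lemma inner_flat_symm (x : M) (l : Module.Dual ℝ (TangentSpace 𝓘(ℝ, E) x))
    (w : TangentSpace 𝓘(ℝ, E) x) : g.inner x ((flat g x).symm l) w = l w :=
  LinearMap.congr_fun ((flat g x).apply_symm_apply l) w

lemma inner_ext {x : M} {v w : TangentSpace 𝓘(ℝ, E) x}
    (h : ∀ u, g.inner x v u = g.inner x w u) : v = w :=
  (flat g x).injective (LinearMap.ext h)

open Classical in
/-- `nabla g Y x v = ∇_v Y`: the vector with `2 g(∇_v Y, w) = koszul g X Y Z x` for all vector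
fields `X`, `Z` with `X x = v`, `Z x = w` (and `0` by convention if `Y` is not differentiable
at `x`). -/
def nabla (Y : VField E M) (x : M) : TangentSpace 𝓘(ℝ, E) x →L[ℝ] TangentSpace 𝓘(ℝ, E) x :=
  have : FiniteDimensional ℝ (TangentSpace 𝓘(ℝ, E) x) := inferInstanceAs (FiniteDimensional ℝ E)
  have : T2Space (TangentSpace 𝓘(ℝ, E) x) := FiberBundle.t2Space E _ x
  if hY : MDiffAt (T% Y) x then
    LinearMap.toContinuousLinearMap <| (flat g x).symm.toLinearMap ∘ₗ
      ContinuousLinearMap.coeLM ℝ ∘ₗ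
      ((1 / 2 : ℝ) • (TensorialAt.mkHom₂ (fun X Z ↦ koszul g X Y Z x) x
        (fun _ hZ ↦ koszul_tensorial_left g hY hZ)
        (fun _ hX ↦ koszul_tensorial_right g hX hY))).toLinearMap
  else 0

lemma inner_nabla {X Y Z : VField E M} {x : M} (hX : MDiffAt (T% X) x)
    (hY : MDiffAt (T% Y) x) (hZ : MDiffAt (T% Z) x) :
    2 * g.inner x (nabla g Y x (X x)) (Z x) = koszul g X Y Z x := by
  have h := TensorialAt.mkHom₂_apply (fun _ hZ ↦ koszul_tensorial_left g hY hZ)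
    (fun _ hX ↦ koszul_tensorial_right g hX hY) hX hZ
  rw [nabla, dif_pos hY]
  simp [inner_flat_symm, h]

lemma nabla_ext {x : M} {A B : TangentSpace 𝓘(ℝ, E) x →L[ℝ] TangentSpace 𝓘(ℝ, E) x}
    (h : ∀ X Z : VField E M, MDiffAt (T% X) x → MDiffAt (T% Z) x →
      2 * g.inner x (A (X x)) (Z x) = 2 * g.inner x (B (X x)) (Z x)) : A = B := by
  ext v
  refine inner_ext g fun u ↦ ?_
  have := h (FiberBundle.extend E v) (FiberBundle.extend E u)
    (FiberBundle.mdifferentiableAt_extend ..) (FiberBundle.mdifferentiableAt_extend ..)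
  simpa using this

/-- The Levi-Civita connection of `g`; `leviCivita g Y x (X x)` is `(∇_X Y)(x)`. -/
def leviCivita : CovariantDerivative 𝓘(ℝ, E) E (fun x : M ↦ TangentSpace 𝓘(ℝ, E) x) where
  toFun := nabla g
  isCovariantDerivativeOnUniv :=
    { add := by
        intro Y Y' x hY hY' _
        have := FiniteDimensional.complete ℝ E
        refine nabla_ext g fun X Z hX hZ ↦ ?_
        have h1 := mvfderiv_add (pair_mdiff g hY hZ) (pair_mdiff g hY' hZ)
        have h2 := mvfderiv_add (pair_mdiff g hX hY) (pair_mdiff g hX hY')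
        have b1 := mlieBracket_add_right (V := X) hY hY'
        have b2 := mlieBracket_add_left (W := Z) hY hY'
        have e : 2 * g.inner x ((nabla g Y x + nabla g Y' x) (X x)) (Z x)
          = koszul g X Y Z x + koszul g X Y' Z x := by
          rw [← inner_nabla g hX hY hZ, ← inner_nabla g hX hY' hZ]; simp; ring
        rw [e, inner_nabla g hX (mdifferentiableAt_add_section hY hY') hZ]
        simp only [koszul, pair_add_left, pair_add_right, h1, h2]
        simp [pair, brk, b1, b2]
        ring
      leibniz := by
        intro Y f x hY hf _
        have := FiniteDimensional.complete ℝ E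
        refine nabla_ext g fun X Z hX hZ ↦ ?_
        have h1 := mvfderiv_mul hf (pair_mdiff g hY hZ)
        have h2 := mvfderiv_mul hf (pair_mdiff g hX hY)
        have b1 := mlieBracket_smul_right (V := X) hf hY
        have b2 := mlieBracket_smul_left (W := Z) hf hY
        have e : 2 * g.inner x ((f x • nabla g Y x + (d% f x).smulRight (Y x)) (X x)) (Z x)
          = f x * koszul g X Y Z x + 2 * d% f x (X x) * pair g Y Z x := by
          rw [← inner_nabla g hX hY hZ]; simp [pair]; ring
        rw [e, inner_nabla g hX (hf.smul_section hY) hZ]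
        simp only [koszul, pair_smul_left, pair_smul_right, h1, h2]
        simp [pair, brk, b1, b2, g.symm x (Y x)]
        ring }

/-- The Levi-Civita connection is torsion-free. -/
theorem leviCivita_torsionFree {X Y : VField E M} {x : M}
    (hX : MDiffAt (T% X) x) (hY : MDiffAt (T% Y) x) :
    leviCivita g Y x (X x) - leviCivita g X x (Y x) = brk X Y x := by
  refine inner_ext g fun u ↦ ?_
  have hu : MDiffAt (T% (FiberBundle.extend E u : VField E M)) x :=
    FiberBundle.mdifferentiableAt_extend ..
  have h1 := inner_nabla g hX hY hu
  have h2 := inner_nabla g hY hX hu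
  have b1 : brk Y X = - brk X Y := mlieBracket_swap
  rw [koszul, pair_comm g X Y] at h1
  rw [koszul, b1] at h2
  simp only [pair, Pi.neg_apply, map_neg, neg_apply,
    FiberBundle.extend_apply_self] at h1 h2 ⊢
  have e : g.inner x (leviCivita g Y x (X x) - leviCivita g X x (Y x)) u
      = g.inner x (nabla g Y x (X x)) u - g.inner x (nabla g X x (Y x)) u := by
    rw [map_sub]; rfl
  rw [e]
  linarith

/-- The Levi-Civita connection is compatible with the metric. -/
theorem leviCivita_metric {X Y Z : VField E M} {x : M}
    (hX : MDiffAt (T% X) x) (hY : MDiffAt (T% Y) x) (hZ : MDiffAt (T% Z) x) :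
    d% (pair g Y Z) x (X x) =
      g.inner x (leviCivita g Y x (X x)) (Z x) + g.inner x (Y x) (leviCivita g Z x (X x)) := by
  have h1 := inner_nabla g hX hY hZ
  have h2 := inner_nabla g hX hZ hY
  have b1 : brk Z Y = - brk Y Z := mlieBracket_swap
  rw [koszul] at h1
  rw [koszul, b1, pair_comm g Z Y] at h2
  simp only [pair, Pi.neg_apply, map_neg, neg_apply] at h1 h2
  change _ = g.inner x (nabla g Y x (X x)) (Z x) + g.inner x (Y x) (nabla g Z x (X x))
  rw [g.symm x (Y x)]
  linarith

/-- The curvature tensor `R(X, Y)Z = ∇_X ∇_Y Z - ∇_Y ∇_X Z - ∇_[X,Y] Z`. -/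
def curvature (X Y Z : VField E M) : VField E M := fun x ↦
  leviCivita g (fun y ↦ leviCivita g Z y (Y y)) x (X x)
    - leviCivita g (fun y ↦ leviCivita g Z y (X y)) x (Y x)
    - leviCivita g Z x (brk X Y x)

/-- The sectional curvature `K(X, Y)` of the plane spanned by `X x` and `Y x`. -/
def sectionalCurvature (X Y : VField E M) (x : M) : ℝ :=
  pair g (curvature g X Y Y) X x
    / (pair g X X x * pair g Y Y x - pair g X Y x ^ 2)

end LeviCivita

/-- A metric `f`-manifold structure of rank `2n` with `s` structure vector fields on `M`. -/
structure MetricFStructure (E : Type*) [NormedAddCommGroup E] [NormedSpace ℝ E]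
    (M : Type*) [TopologicalSpace M] [ChartedSpace E M] [IsManifold 𝓘(ℝ, E) ∞ M]
    (n s : ℕ) where
  /-- the Riemannian metric -/
  g : RiemMetric E M
  /-- the `f`-structure, a tensor field of type (1,1) -/
  f : Π x : M, TangentSpace 𝓘(ℝ, E) x →L[ℝ] TangentSpace 𝓘(ℝ, E) x
  /-- the structure vector fields -/
  ξ : Fin s → VField E M
  /-- the dual 1-forms -/
  η : Fin s → Π x : M, TangentSpace 𝓘(ℝ, E) x →L[ℝ] ℝ
  smooth_f : ContMDiff 𝓘(ℝ, E) (𝓘(ℝ, E).prod 𝓘(ℝ, E →L[ℝ] E)) ∞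
    (fun x ↦ TotalSpace.mk' (E →L[ℝ] E)
      (E := fun x : M ↦ TangentSpace 𝓘(ℝ, E) x →L[ℝ] TangentSpace 𝓘(ℝ, E) x) x (f x))
  smooth_ξ : ∀ α, CMDiff ∞ (T% (ξ α))
  smooth_η : ∀ α, ContMDiff 𝓘(ℝ, E) (𝓘(ℝ, E).prod 𝓘(ℝ, E →L[ℝ] ℝ)) ∞
    (fun x ↦ TotalSpace.mk' (E →L[ℝ] ℝ)
      (E := fun x : M ↦ TangentSpace 𝓘(ℝ, E) x →L[ℝ] Bundle.Trivial M ℝ x) x (η α x))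
  rank_f : ∀ x, Module.finrank ℝ (LinearMap.range (f x).toLinearMap) = 2 * n
  f_cubed : ∀ x v, f x (f x (f x v)) + f x v = 0
  η_ξ : ∀ α β x, η α x (ξ β x) = if α = β then 1 else 0
  f_ξ : ∀ α x, f x (ξ α x) = 0
  η_f : ∀ α x v, η α x (f x v) = 0
  f_sq : ∀ x v, f x (f x v) = -v + ∑ α, η α x v • ξ α x
  g_f : ∀ x v w, g.inner x (f x v) (f x w) = g.inner x v w - ∑ α, η α x v * η α x w

namespace MetricFStructure

variable {E : Type*} [NormedAddCommGroup E] [NormedSpace ℝ E]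
  {M : Type*} [TopologicalSpace M] [ChartedSpace E M] [IsManifold 𝓘(ℝ, E) ∞ M]
  {n s : ℕ} (S : MetricFStructure E M n s)

/-- The vector field `fX`. -/
def fApply (X : VField E M) : VField E M := fun x ↦ S.f x (X x)

/-- The function `η_α(X)`. -/
def ηApply (α : Fin s) (X : VField E M) : M → ℝ := fun x ↦ S.η α x (X x)

/-- The function `η̄(X)`, where `η̄ = η_1 + ⋯ + η_s`. -/
def ηBar (X : VField E M) : M → ℝ := fun x ↦ ∑ α, S.ηApply α X x

/-- The exterior derivative of `η_α`, with the normalization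
`dη(X, Y) = (X(η(Y)) - Y(η(X)) - η([X, Y])) / 2`. -/
def dη (α : Fin s) (X Y : VField E M) (x : M) : ℝ :=
  (1 / 2) * (d% (S.ηApply α Y) x (X x) - d% (S.ηApply α X) x (Y x) - S.ηApply α (brk X Y) x)

/-- Metric `f`-contact manifolds: `dη_α = F` for all `α`, where `F(X, Y) = g(X, fY)`. -/
def IsFContact : Prop :=
  ∀ (α : Fin s) (X Y : VField E M), CMDiff ∞ (T% X) → CMDiff ∞ (T% Y) →
    ∀ x, pair S.g X (S.fApply Y) x = S.dη α X Y x

/-- The Nijenhuis tensor `[f, f](X, Y) = f²[X, Y] + [fX, fY] - f[fX, Y] - f[X, fY]`. -/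
def nijenhuis (X Y : VField E M) : VField E M :=
  S.fApply (S.fApply (brk X Y)) + brk (S.fApply X) (S.fApply Y)
    - S.fApply (brk (S.fApply X) Y) - S.fApply (brk X (S.fApply Y))

/-- Normality: `[f, f] + 2 ∑ ξ_α ⊗ dη_α = 0`. -/
def IsNormal : Prop :=
  ∀ X Y : VField E M, CMDiff ∞ (T% X) → CMDiff ∞ (T% Y) →
    ∀ x, S.nijenhuis X Y x + (2 : ℝ) • ∑ α, S.dη α X Y x • S.ξ α x = 0

/-- `S`-manifolds: normal metric `f`-contact manifolds. -/
def IsSManifold : Prop := S.IsFContact ∧ S.IsNormal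

/-- `h_α X`, where `h_α` is half of the Lie derivative of `f` along `ξ_α`. -/
def h (α : Fin s) (X : VField E M) : VField E M :=
  (1 / 2 : ℝ) • (brk (S.ξ α) (S.fApply X) - S.fApply (brk (S.ξ α) X))

section Curvature

variable [FiniteDimensional ℝ E]

/-- Metric `f`-contact manifolds satisfying the `(κ, μ)`-nullity condition. -/
def IsFKappaMu (κ μ : ℝ) : Prop :=
  S.IsFContact ∧
    ∀ (α : Fin s) (X Y : VField E M), CMDiff ∞ (T% X) → CMDiff ∞ (T% Y) → ∀ x,
      curvature S.g X Y (S.ξ α) x =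
        κ • (S.ηBar X x • S.fApply (S.fApply Y) x - S.ηBar Y x • S.fApply (S.fApply X) x)
        + μ • (S.ηBar Y x • S.h α X x - S.ηBar X x • S.h α Y x)

/-- The `f`-sectional curvature `K(X, fX)`, for unit vectors `X` orthogonal to the structure
vector fields, is constant on the whole of `M`. -/
def HasConstantFSectionalCurvature : Prop :=
  ∃ c : ℝ, ∀ X : VField E M, CMDiff ∞ (T% X) → ∀ x, (∀ α, S.ηApply α X x = 0) →
    pair S.g X X x = 1 → sectionalCurvature S.g X (S.fApply X) x = c

/-- `f`-`(κ, μ)`-space-forms. -/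
def IsFKappaMuSpaceForm (κ μ : ℝ) : Prop :=
  S.IsFKappaMu κ μ ∧ S.HasConstantFSectionalCurvature

/-- `S`-space-forms. -/
def IsSSpaceForm : Prop := S.IsSManifold ∧ S.HasConstantFSectionalCurvature

/-- Generalized `S`-space-forms with two structure vector fields `ξ_1 = S.ξ 0`, `ξ_2 = S.ξ 1`. -/
def IsGeneralizedSSpaceForm (S : MetricFStructure E M n 2) : Prop :=
  ∃ F₁ F₂ F₃ F₄ F₅ F₆ F₇ : M → ℝ,
    CMDiff ∞ F₁ ∧ CMDiff ∞ F₂ ∧ CMDiff ∞ F₃ ∧ CMDiff ∞ F₄ ∧ CMDiff ∞ F₅ ∧ CMDiff ∞ F₆ ∧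
    CMDiff ∞ F₇ ∧
    ∀ X Y Z : VField E M, CMDiff ∞ (T% X) → CMDiff ∞ (T% Y) → CMDiff ∞ (T% Z) → ∀ x,
      letI gg := fun U V : VField E M ↦ pair S.g U V x
      letI f := S.fApply
      letI η₁ := fun U : VField E M ↦ S.ηApply 0 U x
      letI η₂ := fun U : VField E M ↦ S.ηApply 1 U x
      letI ξ₁ := S.ξ 0 x
      letI ξ₂ := S.ξ 1 x
      curvature S.g X Y Z x =
        F₁ x • (gg Y Z • X x - gg X Z • Y x)
        + F₂ x • (gg X (f Z) • f Y x - gg Y (f Z) • f X x + (2 * gg X (f Y)) • f Z x)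
        + F₃ x • ((η₁ X * η₁ Z) • Y x - (η₁ Y * η₁ Z) • X x
            + (gg X Z * η₁ Y) • ξ₁ - (gg Y Z * η₁ X) • ξ₁)
        + F₄ x • ((η₂ X * η₂ Z) • Y x - (η₂ Y * η₂ Z) • X x
            + (gg X Z * η₂ Y) • ξ₂ - (gg Y Z * η₂ X) • ξ₂)
        + F₅ x • ((η₁ X * η₂ Z) • Y x - (η₁ Y * η₂ Z) • X x
            + (gg X Z * η₁ Y) • ξ₂ - (gg Y Z * η₁ X) • ξ₂)
        + F₆ x • ((η₂ X * η₁ Z) • Y x - (η₂ Y * η₁ Z) • X x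
            + (gg X Z * η₂ Y) • ξ₁ - (gg Y Z * η₂ X) • ξ₁)
        + F₇ x • ((η₁ X * η₂ Y * η₂ Z) • ξ₁ - (η₂ X * η₁ Y * η₂ Z) • ξ₁
            + (η₂ X * η₁ Y * η₁ Z) • ξ₂ - (η₁ X * η₂ Y * η₁ Z) • ξ₂)

end Curvature

end MetricFStructure

end

end FGeom

/-! Under the hypotheses, a nonempty $M$ has $\kappa=1$ and is automatically normal. The implication
to the right is then immediate. In the converse, the $S$-space-form case only passes on the
curvature condition, and the case $\kappa=-1$ can occur only on the empty manifold, where the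
curvature condition is vacuous.

Write $\nabla_X\xi_\alpha=-fX-B_\alpha X$. The contact condition makes $B_\alpha$ symmetric and
kills it on the $\xi_\beta$. The generalized space-form formula makes
$R(\cdot,\xi_\alpha)\xi_\alpha$ scalar on horizontal fields, while $h_\alpha$ anticommutes with $f$,
so the $\mu$-terms of the nullity condition vanish (`nullity_of_scalar`). What remains gives a
Riccati equation along the $\xi_\beta$, hence $B_\alpha f=-fB_\alpha$ and $B_\alpha
B_\beta=-(1-\kappa)f^2$. In particular $\|B_\alpha X\|^2=(1-\kappa)\|fX\|^2$, so $\kappa\le1$.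

Suppose $\kappa<1$ and put $l=\sqrt{1-\kappa}$. The horizontal bundle splits into the
$l$-eigenbundle of $B\circ f$ and its image under $f$. The Codazzi equation, read component by
component in this splitting, shows that $\nabla f$ has no horizontal part (`Nullity.dl_f_of_plus`).
So $\nabla f$ is determined by $\nabla\xi$, and the commutator of curvature with $f$ is explicit
(`Nullity.Rm_f`). Compared with the space-form formula on two eigenfields and on their images under
$f$, it forces $l$ times their Gram determinant to vanish (`Nullity.gram_eq_zero`). Since $n>1$, the
eigenbundle contains two independent directions, a contradiction (`kappa_eq_one`).

For $\kappa=1$ all $B_\alpha$ vanish, Codazzi again removes the horizontal part of $\nabla f$, and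
the resulting formula for $\nabla f$ gives normality (`Nullity.normal`). The tensor calculus runs
over the ring of smooth functions acting on the module of smooth fields; positivity of the metric
enters only on returning to the manifold. -/

/-- Algebraic model of the smooth vector fields on a Riemannian manifold: `R` stands for the ring of
smooth functions, `V` for the smooth vector fields, `D` for the derivative of a function along a field
and `nab` for the Levi-Civita connection. -/
structure LCAlgebra (R V : Type*) [CommRing R] [AddCommGroup V] [Module R V] where
  g : V →ₗ[R] V →ₗ[R] R
  g_symm : ∀ X Y, g X Y = g Y X
  g_nondeg : ∀ X, (∀ Y, g X Y = 0) → X = 0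
  two_unit : IsUnit (2 : R)
  D : V → R → R
  D_mul : ∀ X a b, D X (a * b) = D X a * b + a * D X b
  D_add : ∀ X a b, D X (a + b) = D X a + D X b
  nab : V →ₗ[R] V → V
  nab_add : ∀ X Y Z, nab X (Y + Z) = nab X Y + nab X Z
  nab_smul : ∀ X (a : R) Y, nab X (a • Y) = D X a • Y + a • nab X Y
  metric : ∀ X Y Z, D X (g Y Z) = g (nab X Y) Z + g Y (nab X Z)
  jacobi : ∀ X Y Z,
    nab X (nab Y Z - nab Z Y) - nab (nab Y Z - nab Z Y) X
      = (nab (nab X Y - nab Y X) Z - nab Z (nab X Y - nab Y X))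
        + (nab Y (nab X Z - nab Z X) - nab (nab X Z - nab Z X) Y)

/-- Algebraic model of the smooth vector fields on a metric `f`-contact manifold with two structure
vector fields. -/
structure FContactAlgebra (R V : Type*) [CommRing R] [AddCommGroup V] [Module R V]
    extends LCAlgebra R V where
  f : V →ₗ[R] V
  ξ : Fin 2 → V
  f_skew : ∀ X Y, g (f X) Y = - g X (f Y)
  f_ξ : ∀ α, f (ξ α) = 0
  f_sq : ∀ X, f (f X) = - X + g (ξ 0) X • ξ 0 + g (ξ 1) X • ξ 1
  ξ_ξ : ∀ α β, g (ξ α) (ξ β) = if α = β then 1 else 0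
  contact : ∀ α X Y, D X (g (ξ α) Y) - D Y (g (ξ α) X) - g (ξ α) (nab X Y - nab Y X)
    = 2 * g X (f Y)

/-! ### Formal Levi-Civita calculus -/

namespace LCAlgebra
variable {R V : Type*} [CommRing R] [AddCommGroup V] [Module R V]

lemma cancel_two (L : LCAlgebra R V) {a : R} (h : 2 * a = 0) : a = 0 := by
  obtain ⟨u, hu⟩ := L.two_unit
  rw [← hu] at h
  exact (Units.mul_right_eq_zero u).1 h

lemma cancel_two_smul (L : LCAlgebra R V) {X : V} (h : (2 : R) • X = 0) : X = 0 :=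
  (L.two_unit.smul_eq_zero).1 h

variable (L : LCAlgebra R V)

lemma ext_g {X Y : V} (h : ∀ Z, L.g X Z = L.g Y Z) : X = Y :=
  sub_eq_zero.1 (L.g_nondeg _ fun Z ↦ by simp [h Z])

lemma D_zero (X : V) : L.D X 0 = 0 := by
  have := L.D_add X 0 0
  simpa using this

lemma D_one (X : V) : L.D X 1 = 0 := by
  have := L.D_mul X 1 1
  simpa using this

lemma D_neg (X : V) (a : R) : L.D X (-a) = - L.D X a := by
  have := L.D_add X a (-a)
  rw [add_neg_cancel, L.D_zero] at this
  linear_combination -this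

lemma nab_zero (X : V) : L.nab X 0 = 0 := by
  have := L.nab_add X 0 0
  simpa using this

lemma nab_neg (X Y : V) : L.nab X (-Y) = - L.nab X Y := by
  have := L.nab_add X Y (-Y)
  rw [add_neg_cancel, L.nab_zero] at this
  linear_combination (norm := module) -this

lemma nab_sub (X Y Z : V) : L.nab X (Y - Z) = L.nab X Y - L.nab X Z := by
  rw [sub_eq_add_neg, L.nab_add, L.nab_neg, sub_eq_add_neg]

lemma nab_add_left (X Y Z : V) : L.nab (X + Y) Z = L.nab X Z + L.nab Y Z := by simp
lemma nab_sub_left (X Y Z : V) : L.nab (X - Y) Z = L.nab X Z - L.nab Y Z := by simp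
lemma nab_neg_left (X Z : V) : L.nab (-X) Z = - L.nab X Z := by simp
lemma nab_smul_left (a : R) (X Z : V) : L.nab (a • X) Z = a • L.nab X Z := by simp

/-- The Lie bracket. -/
def brk (X Y : V) : V := L.nab X Y - L.nab Y X

/-- The curvature tensor. -/
def Rm (X Y Z : V) : V := L.nab X (L.nab Y Z) - L.nab Y (L.nab X Z) - L.nab (L.brk X Y) Z

/-- The covariant derivative `∇_U T` of an endomorphism `T`. -/
def dl (T : V →ₗ[R] V) (U X : V) : V := L.nab U (T X) - T (L.nab U X)

lemma dl_neg (T : V →ₗ[R] V) (U X : V) : L.dl (-T) U X = - L.dl T U X := by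
  simp only [dl, LinearMap.neg_apply, L.nab_neg]; module

lemma dl_sub (T T' : V →ₗ[R] V) (U X : V) : L.dl (T - T') U X = L.dl T U X - L.dl T' U X := by
  simp only [dl, LinearMap.sub_apply, L.nab_sub]; module

lemma dl_comp (T T' : V →ₗ[R] V) (U X : V) :
    L.dl (T ∘ₗ T') U X = L.dl T U (T' X) + T (L.dl T' U X) := by
  simp only [dl, LinearMap.comp_apply, map_sub]; module

lemma dl_add_left (T : V →ₗ[R] V) (U U' X : V) :
    L.dl T (U + U') X = L.dl T U X + L.dl T U' X := by
  simp only [dl, L.nab_add_left, map_add]; module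

lemma dl_smul_left (T : V →ₗ[R] V) (a : R) (U X : V) :
    L.dl T (a • U) X = a • L.dl T U X := by
  simp only [dl, L.nab_smul_left, map_smul]; module

lemma dl_add_right (T : V →ₗ[R] V) (U X Y : V) :
    L.dl T U (X + Y) = L.dl T U X + L.dl T U Y := by
  simp only [dl, L.nab_add, map_add]; module

lemma dl_smul_right (T : V →ₗ[R] V) (a : R) (U X : V) :
    L.dl T U (a • X) = a • L.dl T U X := by
  simp only [dl, L.nab_smul, map_smul, map_add]; module

lemma dl_skew {T : V →ₗ[R] V} (hT : ∀ X Y, L.g (T X) Y = - L.g X (T Y)) (U X Y : V) :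
    L.g (L.dl T U X) Y = - L.g X (L.dl T U Y) := by
  have h1 := L.metric U (T X) Y
  have h2 := L.metric U X (T Y)
  have h3 := hT (L.nab U X) Y
  have h4 := hT X (L.nab U Y)
  rw [hT X Y, L.D_neg] at h1
  simp only [dl, map_sub, LinearMap.sub_apply]
  linear_combination -h1 - h2 - h3 - h4

lemma dl_symm {T : V →ₗ[R] V} (hT : ∀ X Y, L.g (T X) Y = L.g X (T Y)) (U X Y : V) :
    L.g (L.dl T U X) Y = L.g X (L.dl T U Y) := by
  have h1 := L.metric U (T X) Y
  have h2 := L.metric U X (T Y)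
  have h3 := hT (L.nab U X) Y
  have h4 := hT X (L.nab U Y)
  rw [hT X Y] at h1
  simp only [dl, map_sub, LinearMap.sub_apply]
  linear_combination -h1 + h2 - h3 - h4

end LCAlgebra

/-! ### Structure vector fields of a metric $f$-contact manifold -/

namespace FContactAlgebra
variable {R V : Type*} [CommRing R] [AddCommGroup V] [Module R V] (L : FContactAlgebra R V)

open LCAlgebra

/-- The endomorphism `X ↦ ∇_X ξ_α`. -/
def A (α : Fin 2) : V →ₗ[R] V where
  toFun X := L.nab X (L.ξ α)
  map_add' X Y := L.nab_add_left X Y _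
  map_smul' a X := L.nab_smul_left a X _

/-- The endomorphism with `∇_X ξ_α = - f X - B_α X`. -/
def B (α : Fin 2) : V →ₗ[R] V := - L.A α - L.f

lemma A_def (α : Fin 2) (X : V) : L.A α X = L.nab X (L.ξ α) := rfl

lemma A_eq (α : Fin 2) (X : V) : L.A α X = - L.f X - L.B α X := by
  simp only [B, LinearMap.sub_apply, LinearMap.neg_apply]; module

lemma g_f_ξ (α : Fin 2) (X : V) : L.g (L.ξ α) (L.f X) = 0 := by
  have := L.f_skew (L.ξ α) X
  rw [L.f_ξ] at this
  simpa using this.symm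

lemma D_ξ_ξ (X : V) (α β : Fin 2) : L.D X (L.g (L.ξ α) (L.ξ β)) = 0 := by
  rw [L.ξ_ξ]; split_ifs
  · exact L.D_one X
  · exact L.D_zero X

lemma A_contact (α : Fin 2) (X Y : V) :
    L.g (L.A α X) Y - L.g (L.A α Y) X = 2 * L.g X (L.f Y) := by
  have h := L.contact α X Y
  rw [L.metric, L.metric, map_sub] at h
  rw [← h, A_def, A_def]; ring

/-- The contact condition says that the skew part of $\nabla\xi_\alpha$ is $-f$; $-B_\alpha$ is the
symmetric part. -/
lemma B_symm (α : Fin 2) (X Y : V) : L.g (L.B α X) Y = L.g X (L.B α Y) := by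
  have h := L.A_contact α X Y
  have h1 := L.f_skew X Y
  have h2 := L.g_symm (L.A α Y) X
  simp only [B, LinearMap.sub_apply, LinearMap.neg_apply, map_sub, map_neg]
  linear_combination -h - h1 - h2

/-- This is $L_{\xi_\alpha}\eta_\beta=0$: the contraction of $d\eta_\beta$ with $\xi_\alpha$
vanishes because $f\xi_\alpha=0$, and $\eta_\beta(\xi_\alpha)$ is constant. -/
lemma D_ξ (α β : Fin 2) (X : V) :
    L.D (L.ξ α) (L.g (L.ξ β) X) = L.g (L.ξ β) (L.brk (L.ξ α) X) := by
  have h := L.contact β (L.ξ α) X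
  rw [D_ξ_ξ, g_f_ξ] at h
  rw [brk]; linear_combination h

lemma A_ξ_add (α β : Fin 2) (X : V) :
    L.g (L.A α X) (L.ξ β) + L.g (L.ξ α) (L.A β X) = 0 := by
  rw [A_def, A_def, ← L.metric, D_ξ_ξ]

lemma brk_smul (X : V) (a : R) (Y : V) :
    L.brk X (a • Y) = L.D X a • Y + a • L.brk X Y := by
  simp only [brk, L.nab_smul, L.nab_smul_left]; module

lemma jacobi' (X Y Z : V) :
    L.brk X (L.brk Y Z) = L.brk (L.brk X Y) Z + L.brk Y (L.brk X Z) := L.jacobi X Y Z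

lemma brk_add (X Y Z : V) : L.brk X (Y + Z) = L.brk X Y + L.brk X Z := by
  simp only [brk, L.nab_add, L.nab_add_left]; module

/-- The model does not postulate this; it follows from the Jacobi identity applied to $a\,\xi_0$ and
pairing with $\xi_0$. -/
lemma D_brk (X Y : V) (a : R) :
    L.D (L.brk X Y) a = L.D X (L.D Y a) - L.D Y (L.D X a) := by
  have h := L.jacobi' X Y (a • L.ξ 0)
  have h' := L.jacobi' X Y (L.ξ 0)
  simp only [brk_smul, brk_add] at h
  have h1 : L.D (L.brk X Y) a • L.ξ 0 = (L.D X (L.D Y a) - L.D Y (L.D X a)) • L.ξ 0 := by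
    linear_combination (norm := module) a • h' - h
  have h2 := congrArg (L.g (L.ξ 0)) h1
  simpa [L.ξ_ξ] using h2

lemma f_eq_zero {X : V} (h0 : ∀ α, L.g (L.ξ α) X = 0) (h : L.f X = 0) : X = 0 := by
  have := L.f_sq X
  rw [h, h0, h0] at this
  simpa using this

/-- Since $L_{\xi_\gamma}\eta_\delta=0$, the bracket is horizontal and also preserves $\eta_0$.
Hence its contraction with $d\eta_0$ vanishes, which means that $f$ kills it. -/
lemma brk_ξ (α β : Fin 2) : L.brk (L.ξ α) (L.ξ β) = 0 := by
  have h0 : ∀ γ, L.g (L.ξ γ) (L.brk (L.ξ α) (L.ξ β)) = 0 := fun γ ↦ by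
    rw [← D_ξ, D_ξ_ξ]
  refine L.f_eq_zero h0 (L.g_nondeg _ fun X ↦ ?_)
  have h := L.contact 0 (L.brk (L.ξ α) (L.ξ β)) X
  rw [h0, L.D_zero, D_brk, D_ξ, D_ξ, D_ξ, D_ξ] at h
  have hj := congrArg (L.g (L.ξ 0)) (L.jacobi' (L.ξ α) (L.ξ β) X)
  rw [map_add] at hj
  have e : L.nab (L.brk (L.ξ α) (L.ξ β)) X - L.nab X (L.brk (L.ξ α) (L.ξ β))
    = L.brk (L.brk (L.ξ α) (L.ξ β)) X := rfl
  rw [e] at h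
  have : 2 * L.g (L.brk (L.ξ α) (L.ξ β)) (L.f X) = 0 := by linear_combination -h + hj
  rw [L.f_skew, L.cancel_two this, neg_zero]

lemma A_ξ_comm (α β : Fin 2) : L.A α (L.ξ β) = L.A β (L.ξ α) :=
  (sub_eq_zero.1 (L.brk_ξ α β)).symm

/-- Constancy of $g(\xi_\alpha,\xi_\beta)$, the contact condition for both indices and
$[\xi_\alpha,\xi_\beta]=0$ add up to $2g(\nabla_{\xi_\beta}\xi_\alpha,X)=0$. -/
lemma A_ξ (α β : Fin 2) : L.A α (L.ξ β) = 0 := by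
  refine L.g_nondeg _ fun X ↦ L.cancel_two ?_
  have h1 := L.A_ξ_add α β X
  have h2 := L.A_contact α (L.ξ β) X
  have h3 := L.A_contact β (L.ξ α) X
  rw [g_f_ξ] at h2 h3
  have h4 := L.g_symm (L.ξ α) (L.A β X)
  rw [L.A_ξ_comm β α] at h3
  linear_combination h1 + h2 + h3 - h4

lemma ξ_A (α β : Fin 2) (X : V) : L.g (L.ξ β) (L.A α X) = 0 := by
  have h2 := L.A_contact α (L.ξ β) X
  rw [g_f_ξ, A_ξ] at h2
  rw [L.g_symm]
  simpa using h2

lemma B_ξ (α β : Fin 2) : L.B α (L.ξ β) = 0 := by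
  simp [B, L.A_ξ, L.f_ξ]

lemma ξ_B (α β : Fin 2) (X : V) : L.g (L.ξ β) (L.B α X) = 0 := by
  simp [B, L.ξ_A, g_f_ξ]

/-- The `f`-invariant distribution `⋂ ker η_α`. -/
def IsHor (X : V) : Prop := ∀ α, L.g (L.ξ α) X = 0

variable {L}
lemma IsHor.f_sq {X : V} (h : L.IsHor X) : L.f (L.f X) = - X := by
  rw [L.f_sq, h 0, h 1]; simp
variable (L)

lemma isHor_f (X : V) : L.IsHor (L.f X) := fun α ↦ L.g_f_ξ α X
lemma isHor_B (α : Fin 2) (X : V) : L.IsHor (L.B α X) := fun β ↦ L.ξ_B α β X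

lemma B_f_f (α : Fin 2) (X : V) : L.B α (L.f (L.f X)) = - L.B α X := by
  rw [L.f_sq]; simp [L.B_ξ]

lemma f_f_f (X : V) : L.f (L.f (L.f X)) = - L.f X := (L.isHor_f X).f_sq

lemma f_f_B (α : Fin 2) (X : V) : L.f (L.f (L.B α X)) = - L.B α X := (L.isHor_B α X).f_sq

/-- Covariant derivative of the contact condition. -/
lemma dl_f (α : Fin 2) (U X Y : V) :
    2 * L.g X (L.dl L.f U Y) = L.g (L.dl (L.A α) U X) Y - L.g (L.dl (L.A α) U Y) X := by
  have hs := L.dl_symm (L.B_symm α) U X Y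
  have hk := L.dl_skew L.f_skew U X Y
  have e : ∀ Z, L.dl (L.A α) U Z = - L.dl L.f U Z - L.dl (L.B α) U Z := fun Z ↦ by
    rw [← L.dl_neg, ← L.dl_sub]; congr 1; simp only [B]; module
  have s1 := L.g_symm (L.dl L.f U Y) X
  have s2 := L.g_symm (L.dl (L.B α) U Y) X
  simp only [e, map_sub, map_neg, LinearMap.sub_apply, LinearMap.neg_apply]
  linear_combination hk + hs - s1 - s2

/-! ### The reduced nullity condition and the algebra of $B_\alpha$ -/

/-- `η̄ X`. -/
def ηb (X : V) : R := L.g (L.ξ 0) X + L.g (L.ξ 1) X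

lemma ηb_ξ (β : Fin 2) : L.ηb (L.ξ β) = 1 := by
  fin_cases β <;> simp [ηb, L.ξ_ξ]

/-- The nullity condition with the terms in `h_α` dropped. -/
def Nullity (k : R) : Prop := ∀ α X Y,
  L.Rm X Y (L.ξ α) = k • (L.ηb X • L.f (L.f Y) - L.ηb Y • L.f (L.f X))

variable {L} {k : R}

/-- Riccati equation: the curvature $R(X,\xi_\beta)\xi_\alpha$ rewritten with
$\nabla_{\xi_\beta}\xi_\alpha=0$. -/
lemma Nullity.dl_A (hk : L.Nullity k) (α β : Fin 2) (X : V) :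
    L.dl (L.A α) (L.ξ β) X = k • L.f (L.f X) - L.A α (L.A β X) := by
  have h := hk α X (L.ξ β)
  have e1 : L.nab (L.ξ β) (L.ξ α) = 0 := L.A_ξ α β
  rw [L.f_ξ, map_zero, L.ηb_ξ, Rm, brk, e1, L.nab_zero, L.nab_sub_left] at h
  have e2 : L.nab (L.nab X (L.ξ β)) (L.ξ α) = L.A α (L.A β X) := rfl
  rw [e2] at h
  simp only [dl, A_def] at h ⊢
  linear_combination (norm := module) -h

/-- The skew part of the Riccati equation. The term $kf^2$ is symmetric, and the skew part of
$A_\alpha^2=(f+B_\alpha)^2$ is $fB_\alpha+B_\alpha f$. -/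
lemma Nullity.dl_f_self (hk : L.Nullity k) (α : Fin 2) (X : V) :
    L.dl L.f (L.ξ α) X = L.f (L.B α X) + L.B α (L.f X) := by
  refine L.ext_g fun Z ↦ sub_eq_zero.1 (L.cancel_two ?_)
  have h := L.dl_f α (L.ξ α) Z X
  simp only [hk.dl_A, A_eq, map_sub, map_neg, LinearMap.sub_apply, LinearMap.neg_apply,
    map_smul, LinearMap.smul_apply] at h
  have a1 := L.f_skew (L.f Z) X
  have a2 := L.f_skew Z (L.f X)
  have a3 := L.f_skew (L.B α Z) X
  have a4 := L.B_symm α (L.f Z) X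
  have a5 := L.B_symm α Z (L.f X)
  have a6 := L.f_skew Z (L.B α X)
  have a7 := L.B_symm α (L.B α Z) X
  have a8 := L.B_symm α Z (L.B α X)
  have c1 := L.g_symm Z (L.f (L.f X))
  have c2 := L.g_symm Z (L.f (L.B α X))
  have c3 := L.g_symm Z (L.B α (L.f X))
  have c4 := L.g_symm Z (L.B α (L.B α X))
  have c5 := L.g_symm Z (L.dl L.f (L.ξ α) X)
  simp only [map_add, LinearMap.add_apply, smul_eq_mul] at h ⊢
  linear_combination h + (k-1) * (a1 - a2 + c1) - a3 - a4 + a5 - a6 - a7 - a8 - c4 - 2 * c5 + c2 + c3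

/-- The fields $\xi_\beta$, hence also $f^2$, are parallel along $\xi_\alpha$. -/
lemma dl_f_f (α : Fin 2) (X : V) :
    L.dl L.f (L.ξ α) (L.f X) + L.f (L.dl L.f (L.ξ α) X) = 0 := by
  have e1 : ∀ β, L.nab (L.ξ α) (L.ξ β) = 0 := fun β ↦ L.A_ξ β α
  have h := L.dl_comp L.f L.f (L.ξ α) X
  rw [← h]
  simp only [dl, LinearMap.comp_apply, L.f_sq, L.nab_add, L.nab_smul, L.nab_neg, L.metric, e1]
  simp

/-- Inserting $\nabla_{\xi_\alpha}f=fB_\alpha+B_\alpha f$ into the derivative of $f^2$ leaves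
$fB_\alpha f=B_\alpha$; applying $f$ once more gives the claim. -/
lemma Nullity.anticomm (hk : L.Nullity k) (α : Fin 2) (X : V) :
    L.B α (L.f X) = - L.f (L.B α X) := by
  have h := dl_f_f (L := L) α X
  rw [hk.dl_f_self, hk.dl_f_self, map_add, B_f_f, f_f_B] at h
  have h2 : L.f (L.B α (L.f X)) = L.B α X := by
    refine sub_eq_zero.1 (L.cancel_two_smul ?_)
    linear_combination (norm := module) h
  have h3 := congrArg L.f h2
  rw [f_f_B] at h3
  rw [← h3, neg_neg]

lemma Nullity.dl_f_ξ (hk : L.Nullity k) (α : Fin 2) (X : V) : L.dl L.f (L.ξ α) X = 0 := by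
  rw [hk.dl_f_self, hk.anticomm]; simp

lemma Nullity.dl_B (hk : L.Nullity k) (α β : Fin 2) (X : V) :
    L.dl (L.B α) (L.ξ β) X = L.A α (L.A β X) - k • L.f (L.f X) := by
  have e : L.B α = - L.A α - L.f := rfl
  rw [e, L.dl_sub, L.dl_neg, hk.dl_f_ξ, hk.dl_A]; module

/-- Differentiate $B_\alpha f+fB_\alpha=0$ along $\xi_\beta$, where $f$ is parallel and the Riccati
equation gives the derivative of $B_\alpha$. -/
lemma Nullity.B_B (hk : L.Nullity k) (α β : Fin 2) (X : V) :
    L.B α (L.B β X) = - (1 - k) • L.f (L.f X) := by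
  have h : L.dl (L.B α) (L.ξ β) (L.f X) + L.f (L.dl (L.B α) (L.ξ β) X) = 0 := by
    have h1 := L.dl_comp (L.B α) L.f (L.ξ β) X
    have h2 := L.dl_comp L.f (L.B α) (L.ξ β) X
    have h3 : L.B α ∘ₗ L.f = - (L.f ∘ₗ L.B α) := LinearMap.ext (hk.anticomm α)
    rw [h3, L.dl_neg, h2, hk.dl_f_ξ, hk.dl_f_ξ, map_zero] at h1
    linear_combination (norm := module) -h1
  simp only [hk.dl_B, A_eq, map_sub, map_neg, map_smul, hk.anticomm, f_f_B, f_f_f, neg_neg] at h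
  have h4 : L.f (L.B α (L.B β X)) = (1 - k) • L.f X := by
    refine sub_eq_zero.1 (L.cancel_two_smul ?_)
    linear_combination (norm := module) h
  have h5 := congrArg L.f h4
  rw [f_f_B, map_smul] at h5
  linear_combination (norm := module) -h5

/-- The product $B_\alpha B_\beta$ does not depend on the indices, so $B_\beta(B_\alpha-B_\beta)=0$,
while $B_\beta^2$ is the invertible scalar $1-k$ on horizontal fields. -/
lemma Nullity.B_eq (hk : L.Nullity k) (hu : IsUnit (1 - k)) (α β : Fin 2) : L.B α = L.B β := by
  ext X
  have h1 : L.B β (L.B α X - L.B β X) = 0 := by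
    rw [map_sub, hk.B_B, hk.B_B, sub_self]
  have h2 := hk.B_B β β (L.B α X - L.B β X)
  rw [h1, map_zero, map_sub, map_sub, f_f_B, f_f_B] at h2
  have h3 : (1 - k) • (L.B α X - L.B β X) = 0 := by linear_combination (norm := module) -h2
  exact sub_eq_zero.1 (hu.smul_eq_zero.1 h3)

lemma Nullity.g_B_B (hk : L.Nullity k) (α : Fin 2) (X : V) :
    L.g (L.B α X) (L.B α X) = (1 - k) * L.g (L.f X) (L.f X) := by
  rw [B_symm, hk.B_B, L.f_skew]; simp; ring

/-- On horizontal arguments the right-hand side of the nullity condition is zero, so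
$R(X,Y)\xi_\alpha=0$. -/
lemma Nullity.codazzi (hk : L.Nullity k) (α : Fin 2) {X Y : V} (hX : L.IsHor X) (hY : L.IsHor Y) :
    L.nab X (L.A α Y) - L.nab Y (L.A α X) = L.A α (L.brk X Y) := by
  have h := hk α X Y
  have e : ∀ {Z}, L.IsHor Z → L.ηb Z = 0 := fun h ↦ by simp [ηb, h 0, h 1]
  rw [e hX, e hY, Rm] at h
  simp only [A_def]
  linear_combination (norm := module) h

end FContactAlgebra

/-! ### Horizontal part of $\nabla f$ and eigenfields of $B\circ f$ -/

namespace FContactAlgebra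
variable {R V : Type*} [CommRing R] [AddCommGroup V] [Module R V] {L : FContactAlgebra R V}

lemma dl_f_swap (X Y Z : V) : L.g (L.dl L.f X Y) Z = - L.g (L.dl L.f X Z) Y := by
  rw [L.dl_skew L.f_skew, L.g_symm]

lemma isHor_add {X Y : V} (hX : L.IsHor X) (hY : L.IsHor Y) : L.IsHor (X + Y) := fun α ↦ by
  rw [map_add, hX, hY, add_zero]

lemma isHor_smul (a : R) {X : V} (hX : L.IsHor X) : L.IsHor (a • X) := fun α ↦ by
  rw [map_smul, hX, smul_zero]

/-- A form that is symmetric in its first two and skew in its last two arguments vanishes. -/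
lemma eq_zero_of_symm_of_skew (L : LCAlgebra R V) {P : V → Prop} (T : V → V → V → R)
    (hs : ∀ X Y Z, P X → P Y → P Z → T X Y Z = T Y X Z)
    (hk : ∀ X Y Z, P X → P Y → P Z → T X Y Z = - T X Z Y) {X Y Z : V}
    (hX : P X) (hY : P Y) (hZ : P Z) : T X Y Z = 0 := by
  refine L.cancel_two ?_
  linear_combination hs X Y Z hX hY hZ + hk Y X Z hY hX hZ - hs Y Z X hY hZ hX
    - hk Z Y X hZ hY hX + hs Z X Y hZ hX hY + hk X Z Y hX hZ hY

variable {k l : R}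

/-- With $A=-f$ the Codazzi equation makes $(\nabla_Xf)Y$ symmetric in $X,Y$, while $\nabla_Xf$ is
skew. -/
lemma Nullity.dl_f_of_B_eq_zero (hk : L.Nullity k) (hB : L.B 0 = 0) {X Y Z : V}
    (hX : L.IsHor X) (hY : L.IsHor Y) (hZ : L.IsHor Z) : L.g (L.dl L.f X Y) Z = 0 := by
  refine eq_zero_of_symm_of_skew L.toLCAlgebra (fun X Y Z ↦ L.g (L.dl L.f X Y) Z) ?_
    (fun X Y Z _ _ _ ↦ dl_f_swap X Y Z) hX hY hZ
  intro X Y Z hX hY _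
  have h := hk.codazzi 0 hX hY
  have hA : ∀ U, L.A 0 U = - L.f U := fun U ↦ by rw [A_eq, hB]; simp
  rw [hA, hA, hA, L.nab_neg, L.nab_neg, LCAlgebra.brk, map_sub] at h
  have : L.dl L.f X Y = L.dl L.f Y X := by
    simp only [LCAlgebra.dl]
    linear_combination (norm := module) -h
  simp only [this]

variable (L) in
/-- Horizontal `l`-eigenvectors of `B ∘ f`. -/
def IsPlus (l : R) (X : V) : Prop := L.IsHor X ∧ L.B 0 (L.f X) = l • X

namespace IsPlus

lemma B_apply (hk : L.Nullity k) {X : V} (h : L.IsPlus l X) : L.B 0 X = l • L.f X := by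
  have h1 := h.2
  rw [hk.anticomm] at h1
  have h2 := congrArg L.f h1
  rw [map_neg, f_f_B, map_smul, neg_neg] at h2
  exact h2

lemma A_apply (hk : L.Nullity k) {X : V} (h : L.IsPlus l X) : L.A 0 X = -(1 + l) • L.f X := by
  rw [A_eq, h.B_apply hk]; module

lemma A_f (h : L.IsPlus l X) : L.A 0 (L.f X) = (1 - l) • X := by
  rw [A_eq, h.1.f_sq, h.2]; module

lemma g_A (hk : L.Nullity k) {Z : V} (h : L.IsPlus l Z) (W : V) :
    L.g (L.A 0 W) Z = (1 - l) * L.g W (L.f Z) := by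
  rw [A_eq]
  simp only [map_sub, map_neg, LinearMap.sub_apply, LinearMap.neg_apply, L.f_skew, B_symm,
    h.B_apply hk, map_smul, smul_eq_mul]
  ring

lemma g_A_f {Z : V} (h : L.IsPlus l Z) (W : V) :
    L.g (L.A 0 W) (L.f Z) = -(1 + l) * L.g W Z := by
  rw [A_eq]
  simp only [map_sub, map_neg, LinearMap.sub_apply, LinearMap.neg_apply, L.f_skew, B_symm,
    h.1.f_sq, h.2, map_smul, smul_eq_mul]
  ring

/-- On eigenfields $B$ acts as $lf$; it is symmetric and $f$ is skew, so the eigenbundle is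
orthogonal to its image under $f$. -/
lemma g_f (hk : L.Nullity k) (hl : IsUnit l) {X Y : V} (hX : L.IsPlus l X) (hY : L.IsPlus l Y) :
    L.g X (L.f Y) = 0 := by
  have h1 := L.B_symm 0 X Y
  rw [hX.B_apply hk, hY.B_apply hk, map_smul, map_smul, LinearMap.smul_apply, smul_eq_mul,
    smul_eq_mul, L.f_skew] at h1
  obtain ⟨u, rfl⟩ := hl
  refine L.cancel_two ((Units.mul_right_eq_zero u).1 ?_)
  linear_combination -h1

lemma g_f_f {X : V} (hX : L.IsPlus l X) (Y : V) : L.g (L.f X) (L.f Y) = L.g X Y := by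
  rw [L.g_symm, L.f_skew, hX.1.f_sq, L.g_symm]; simp

/-- Differentiating `g(fY, Z) = 0`. -/
lemma g_nab_f (hk : L.Nullity k) (hl : IsUnit l) (U : V) {Y Z : V} (hY : L.IsPlus l Y)
    (hZ : L.IsPlus l Z) : L.g (L.nab U (L.f Y)) Z = - L.g (L.nab U Z) (L.f Y) := by
  have h := L.metric U Z (L.f Y)
  rw [hZ.g_f hk hl hY, L.D_zero, L.g_symm Z] at h
  linear_combination -h

end IsPlus

/-! ### Components of the Codazzi equation in the eigenbundle splitting -/

section Plus

lemma nab_one_add_smul (hD : ∀ X, L.D X l = 0) (X Y : V) :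
    L.nab X ((1 + l) • Y) = (1 + l) • L.nab X Y := by
  rw [L.nab_smul, L.D_add, hD, L.D_one]; module

lemma nab_one_sub_smul (hD : ∀ X, L.D X l = 0) (X Y : V) :
    L.nab X ((1 - l) • Y) = (1 - l) • L.nab X Y := by
  rw [L.nab_smul, sub_eq_add_neg, L.D_add, L.D_neg, hD, L.D_one]; module

variable {X Y Z : V}

lemma codazzi_plus_plus (hk : L.Nullity k) (hD : ∀ X, L.D X l = 0) (hX : L.IsPlus l X)
    (hY : L.IsPlus l Y) :
    -((1 + l) • (L.nab X (L.f Y) - L.nab Y (L.f X))) = L.A 0 (L.nab X Y - L.nab Y X) := by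
  have h := hk.codazzi 0 hX.1 hY.1
  rw [hX.A_apply hk, hY.A_apply hk, neg_smul, neg_smul, L.nab_neg, L.nab_neg,
    nab_one_add_smul hD, nab_one_add_smul hD] at h
  rw [← LCAlgebra.brk, ← h]; module

lemma codazzi_plus_minus (hk : L.Nullity k) (hD : ∀ X, L.D X l = 0) (hX : L.IsPlus l X)
    (hY : L.IsPlus l Y) :
    (1 - l) • L.nab X Y + (1 + l) • L.nab (L.f Y) (L.f X)
      = L.A 0 (L.nab X (L.f Y) - L.nab (L.f Y) X) := by
  have h := hk.codazzi 0 hX.1 (L.isHor_f Y)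
  rw [hX.A_apply hk, hY.A_f, nab_one_sub_smul hD, neg_smul, L.nab_neg, nab_one_add_smul hD] at h
  rw [← LCAlgebra.brk, ← h]; module

/-- `g((∇_U f)Y, fZ)` for eigenvectors. -/
lemma g_dl_f_f (U : V) (hZ : L.IsHor Z) :
    L.g (L.dl L.f U Y) (L.f Z) = L.g (L.nab U (L.f Y)) (L.f Z) - L.g (L.nab U Y) Z := by
  simp only [LCAlgebra.dl, map_sub, LinearMap.sub_apply, L.f_skew (L.nab U Y), hZ.f_sq, map_neg]
  ring

lemma g_dl_f (hk : L.Nullity k) (hl : IsUnit l) (U : V) (hY : L.IsPlus l Y) (hZ : L.IsPlus l Z) :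
    L.g (L.dl L.f U Y) Z = L.g (L.nab U Y) (L.f Z) - L.g (L.nab U Z) (L.f Y) := by
  simp only [LCAlgebra.dl, map_sub, LinearMap.sub_apply, L.f_skew (L.nab U Y),
    hY.g_nab_f hk hl U hZ]
  ring

lemma dl_f_f_skew (U : V) (hY : L.IsHor Y) (hZ : L.IsHor Z) :
    L.g (L.dl L.f U Y) (L.f Z) = - L.g (L.dl L.f U Z) (L.f Y) := by
  have h := L.metric U (L.f Y) (L.f Z)
  have h' := L.metric U Y Z
  have e : L.g (L.f Y) (L.f Z) = L.g Y Z := by rw [L.f_skew, hZ.f_sq]; simp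
  rw [e] at h
  rw [g_dl_f_f U hZ, g_dl_f_f U hY, L.g_symm (L.nab U (L.f Z)), L.g_symm (L.nab U Z)]
  linear_combination h' - h

lemma unit_cancel {a b : R} {u : R} (hu : IsUnit u) (h : u * a = u * b) : a = b :=
  hu.mul_left_cancel h

/-- The four components of `∇f` vanish on eigenvectors. -/
lemma dl_f_plus_f (hk : L.Nullity k) (hl1 : IsUnit (1 + l)) (hD : ∀ X, L.D X l = 0)
    (hX : L.IsPlus l X) (hY : L.IsPlus l Y) (hZ : L.IsPlus l Z) :
    L.g (L.dl L.f X Y) (L.f Z) = 0 := by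
  refine eq_zero_of_symm_of_skew (P := L.IsPlus l) L.toLCAlgebra
    (fun X Y Z ↦ L.g (L.dl L.f X Y) (L.f Z)) ?_
    (fun X Y Z _ hY hZ ↦ dl_f_f_skew X hY.1 hZ.1) hX hY hZ
  intro X Y Z hX hY hZ
  have h := congrArg (fun W ↦ L.g W (L.f Z)) (codazzi_plus_plus hk hD hX hY)
  simp only [hZ.g_A_f] at h
  refine unit_cancel hl1 ?_
  simp only [g_dl_f_f _ hZ.1]
  simp only [map_sub, map_neg, map_smul, LinearMap.sub_apply, LinearMap.neg_apply,
    LinearMap.smul_apply, smul_eq_mul] at h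
  linear_combination -h

/-- The $Z$-component of the mixed Codazzi equation relates this quantity to the one with $X,Z$
exchanged, with factors $1\pm l$. Using it twice leaves the factor $(1+l)^2-(1-l)^2=4l$. Only $l$
and $1+l$ are inverted here; $1-l$ may vanish. -/
lemma nab_minus_plus (hk : L.Nullity k) (hl : IsUnit l) (hl1 : IsUnit (1 + l))
    (hD : ∀ X, L.D X l = 0)
    (hX : L.IsPlus l X) (hY : L.IsPlus l Y) (hZ : L.IsPlus l Z) :
    L.g (L.nab (L.f Y) X) (L.f Z) = 0 := by
  have key : ∀ {X Y Z}, L.IsPlus l X → L.IsPlus l Y → L.IsPlus l Z →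
      (1 + l) * L.g (L.nab (L.f Y) Z) (L.f X) = (1 - l) * L.g (L.nab (L.f Y) X) (L.f Z) := by
    intro X Y Z hX hY hZ
    have h := congrArg (fun W ↦ L.g W Z) (codazzi_plus_minus hk hD hX hY)
    have h0 := dl_f_plus_f hk hl1 hD hX hY hZ
    rw [g_dl_f_f _ hZ.1] at h0
    simp only [hZ.g_A hk] at h
    simp only [map_sub, map_add, map_smul, LinearMap.sub_apply, LinearMap.add_apply,
      LinearMap.smul_apply, smul_eq_mul, hX.g_nab_f hk hl _ hZ] at h
    linear_combination -h - (1 - l) * h0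
  have h1 := key hX hY hZ
  have h2 := key hZ hY hX
  obtain ⟨u, hu⟩ := hl
  have h3 : 2 * (2 * (l * L.g (L.nab (L.f Y) X) (L.f Z))) = 0 := by
    linear_combination (1 + l) * h2 + (1 - l) * h1
  have h4 := L.cancel_two (L.cancel_two h3)
  rw [← hu] at h4
  exact (Units.mul_right_eq_zero u).1 h4

/-- The $fZ$-component of the mixed Codazzi equation. It ties $\nabla_XY$ to $\nabla_{fY}f$, so that
the vanishing of one yields that of the other. -/
lemma nab_plus_eq (hk : L.Nullity k) (hl : IsUnit l) (hD : ∀ X, L.D X l = 0)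
    (hX : L.IsPlus l X) (hY : L.IsPlus l Y) (hZ : L.IsPlus l Z) :
    (1 - l) * L.g (L.nab X Y) (L.f Z) - (1 + l) * L.g (L.nab X Z) (L.f Y)
      = -(1 + l) * L.g (L.dl L.f (L.f Y) X) (L.f Z) := by
  have h := congrArg (fun W ↦ L.g W (L.f Z)) (codazzi_plus_minus hk hD hX hY)
  simp only [hZ.g_A_f] at h
  rw [g_dl_f_f _ hZ.1]
  simp only [map_sub, map_add, map_smul, LinearMap.sub_apply, LinearMap.add_apply,
    LinearMap.smul_apply, smul_eq_mul, hY.g_nab_f hk hl _ hZ] at h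
  linear_combination h

lemma dl_f_minus_f (hk : L.Nullity k) (hl : IsUnit l) (hl1 : IsUnit (1 + l))
    (hD : ∀ X, L.D X l = 0)
    (hX : L.IsPlus l X) (hY : L.IsPlus l Y) (hZ : L.IsPlus l Z) :
    L.g (L.dl L.f (L.f X) Y) (L.f Z) = 0 := by
  refine eq_zero_of_symm_of_skew (P := L.IsPlus l) L.toLCAlgebra
    (fun X Y Z ↦ L.g (L.dl L.f (L.f X) Y) (L.f Z)) ?_
    (fun X Y Z _ hY hZ ↦ dl_f_f_skew (L.f X) hY.1 hZ.1) hX hY hZ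
  intro X Y Z hX hY hZ
  have h := congrArg (fun W ↦ L.g W Z) (codazzi_plus_plus hk hD hX hY)
  simp only [hZ.g_A hk] at h
  simp only [map_sub, map_neg, map_smul, LinearMap.sub_apply, LinearMap.neg_apply,
    LinearMap.smul_apply, smul_eq_mul, hX.g_nab_f hk hl _ hZ, hY.g_nab_f hk hl _ hZ] at h
  have h1 := nab_plus_eq hk hl hD hX hY hZ
  have h2 := nab_plus_eq hk hl hD hY hX hZ
  -- The $Z$-component of the Codazzi equation for $X,Y$ says exactly that the left-hand sides of
  -- `h1` and `h2` agree, which is the symmetry wanted.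
  refine unit_cancel hl1 ?_
  linear_combination h2 - h1 - h

lemma nab_plus_plus (hk : L.Nullity k) (hl : IsUnit l) (hl1 : IsUnit (1 + l))
    (hD : ∀ X, L.D X l = 0)
    (hX : L.IsPlus l X) (hY : L.IsPlus l Y) (hZ : L.IsPlus l Z) :
    L.g (L.nab X Y) (L.f Z) = 0 := by
  have h1 := nab_plus_eq hk hl hD hX hY hZ
  have h2 := nab_plus_eq hk hl hD hX hZ hY
  rw [dl_f_minus_f hk hl hl1 hD hY hX hZ] at h1
  rw [dl_f_minus_f hk hl hl1 hD hZ hX hY] at h2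
  obtain ⟨u, hu⟩ := hl
  have h3 : 2 * (2 * (l * L.g (L.nab X Y) (L.f Z))) = 0 := by
    linear_combination -(1 + l) * h2 - (1 - l) * h1
  have h4 := L.cancel_two (L.cancel_two h3)
  rw [← hu] at h4
  exact (Units.mul_right_eq_zero u).1 h4

lemma dl_f_apply_f (U : V) (hY : L.IsHor Y) (Z : V) (hZ : L.IsHor Z) :
    L.g (L.dl L.f U (L.f Y)) Z = L.g (L.dl L.f U Y) (L.f Z) := by
  rw [g_dl_f_f U hZ]
  simp only [LCAlgebra.dl, map_sub, LinearMap.sub_apply, hY.f_sq, L.nab_neg, L.f_skew, map_neg,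
    LinearMap.neg_apply]
  ring

lemma exists_plus (hk : L.Nullity k) (hl : IsUnit l) (hkl : l * l = 1 - k) (hX : L.IsHor X) :
    ∃ X₁ X₂, L.IsPlus l X₁ ∧ L.IsPlus l X₂ ∧ X = X₁ + L.f X₂ := by
  obtain ⟨u, hu⟩ := hl
  obtain ⟨t, ht⟩ := L.two_unit
  have hu1 : l * ↑u⁻¹ = 1 := by rw [← hu]; simp
  have ht1 : (2 : R) * ↑t⁻¹ = 1 := by rw [← ht]; simp
  generalize (↑u⁻¹ : R) = u' at hu1
  generalize (↑t⁻¹ : R) = t' at ht1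
  have hB : ∀ Y, L.B 0 (L.f (L.f Y)) = - L.B 0 Y := L.B_f_f 0
  have hff : L.f (L.B 0 (L.f X)) = L.B 0 X := by
    rw [hk.anticomm, map_neg, f_f_B, neg_neg]
  have hf1 : L.B 0 (L.f (L.B 0 (L.f X))) = (l * l) • X := by
    rw [hff, hk.B_B, hX.f_sq, hkl]; module
  -- The first witness is the projection $\frac12(1+l^{-1}Bf)X$. The second is $-f$ applied to the
  -- complementary projection $\frac12(1-l^{-1}Bf)X$, simplified with $fBf=B$.
  refine ⟨t' • (X + u' • L.B 0 (L.f X)), -(t' • (L.f X - u' • L.B 0 X)),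
    ⟨isHor_smul _ (isHor_add hX (isHor_smul _ (L.isHor_B _ _))), ?_⟩,
    ⟨?_, ?_⟩, ?_⟩
  · simp only [map_smul, map_add, hf1]
    linear_combination (norm := module) (l * t') • (hu1 • X) - (hu1 • (t' • L.B 0 (L.f X)))
  · rw [← smul_neg, neg_sub, sub_eq_add_neg, ← neg_one_smul R (L.f X)]
    exact isHor_smul _ (isHor_add (isHor_smul _ (L.isHor_B _ _)) (isHor_smul _ (L.isHor_f _)))
  · have hf2 : L.B 0 (L.f (L.B 0 X)) = -((l * l) • L.f X) := by
      rw [hk.anticomm, hk.B_B, map_smul, f_f_f, hkl]; module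
    simp only [map_neg, map_smul, map_sub, hB, hf2]
    linear_combination (norm := module) -(l * t') • (hu1 • L.f X) - (hu1 • (t' • L.B 0 X))
  · have hf3 : L.f (L.B 0 X) = - L.B 0 (L.f X) := by rw [hk.anticomm, neg_neg]
    simp only [map_neg, map_smul, map_sub, hX.f_sq, hf3]
    linear_combination (norm := module) -(ht1 • X)

/-- By trilinearity eight components are to be checked; moving $f$ from the second to the third
argument leaves the four types already treated. -/
lemma Nullity.dl_f_of_plus (hk : L.Nullity k) (hl : IsUnit l) (hl1 : IsUnit (1 + l))
    (hD : ∀ X, L.D X l = 0) (hkl : l * l = 1 - k)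
    (hX : L.IsHor X) (hY : L.IsHor Y) (hZ : L.IsHor Z) : L.g (L.dl L.f X Y) Z = 0 := by
  obtain ⟨X₁, X₂, hX₁, hX₂, rfl⟩ := exists_plus hk hl hkl hX
  obtain ⟨Y₁, Y₂, hY₁, hY₂, rfl⟩ := exists_plus hk hl hkl hY
  obtain ⟨Z₁, Z₂, hZ₁, hZ₂, rfl⟩ := exists_plus hk hl hkl hZ
  have e1 : ∀ {X Y Z}, L.IsPlus l X → L.IsPlus l Y → L.IsPlus l Z →
      L.g (L.dl L.f X Y) Z = 0 := fun hX hY hZ ↦ by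
    rw [g_dl_f hk hl _ hY hZ, nab_plus_plus hk hl hl1 hD hX hY hZ,
      nab_plus_plus hk hl hl1 hD hX hZ hY, sub_zero]
  have e2 : ∀ {X Y Z}, L.IsPlus l X → L.IsPlus l Y → L.IsPlus l Z →
      L.g (L.dl L.f (L.f X) Y) Z = 0 := fun hX hY hZ ↦ by
    rw [g_dl_f hk hl _ hY hZ, nab_minus_plus hk hl hl1 hD hY hX hZ,
      nab_minus_plus hk hl hl1 hD hZ hX hY, sub_zero]
  have e3 : ∀ {X Y Z}, L.IsPlus l X → L.IsPlus l Y → L.IsPlus l Z →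
      L.g (L.dl L.f X Y) (L.f Z) = 0 := fun hX hY hZ ↦ dl_f_plus_f hk hl1 hD hX hY hZ
  have e4 : ∀ {X Y Z}, L.IsPlus l X → L.IsPlus l Y → L.IsPlus l Z →
      L.g (L.dl L.f (L.f X) Y) (L.f Z) = 0 := fun hX hY hZ ↦ dl_f_minus_f hk hl hl1 hD hX hY hZ
  simp only [L.dl_add_left, L.dl_add_right, map_add, LinearMap.add_apply,
    dl_f_apply_f _ hY₂.1 _ hZ₁.1, dl_f_apply_f _ hY₂.1 _ (L.isHor_f Z₂), hZ₂.1.f_sq, map_neg,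
    e1 hX₁ hY₁ hZ₁, e1 hX₁ hY₂ hZ₂, e2 hX₂ hY₁ hZ₁, e2 hX₂ hY₂ hZ₂,
    e3 hX₁ hY₁ hZ₂, e3 hX₁ hY₂ hZ₁, e4 hX₂ hY₁ hZ₂, e4 hX₂ hY₂ hZ₁]
  simp

end Plus

end FContactAlgebra

/-! ### The full $\nabla f$, normality and the curvature commutator -/

namespace FContactAlgebra
variable {R V : Type*} [CommRing R] [AddCommGroup V] [Module R V] {L : FContactAlgebra R V}
variable {k l : R}

lemma decomp (L : FContactAlgebra R V) (X : V) :
    X = - L.f (L.f X) + (L.g (L.ξ 0) X • L.ξ 0 + L.g (L.ξ 1) X • L.ξ 1) := by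
  rw [L.f_sq]; module

lemma isHor_neg_f_f (X : V) : L.IsHor (- L.f (L.f X)) := by
  rw [← map_neg]; exact L.isHor_f _

lemma IsHor.ηb {X : V} (h : L.IsHor X) : L.ηb X = 0 := by simp [FContactAlgebra.ηb, h 0, h 1]

lemma dl_f_ξ_right (hB : ∀ α, L.B α = L.B 0) (X : V) (α : Fin 2) :
    L.dl L.f X (L.ξ α) = - L.f (L.A 0 X) := by
  have : L.A α X = L.A 0 X := by rw [A_eq, A_eq, hB]
  rw [← this, LCAlgebra.dl, L.f_ξ, L.nab_zero, A_def, zero_sub]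

/-- If `∇f` has no horizontal component, it is determined by `A`. -/
lemma Nullity.dl_f_eq (hk : L.Nullity k) (hB : ∀ α, L.B α = L.B 0)
    (H : ∀ X Y Z, L.IsHor X → L.IsHor Y → L.IsHor Z → L.g (L.dl L.f X Y) Z = 0) (X Y : V) :
    L.dl L.f X Y = -(L.g (L.f Y) (L.A 0 X) • (L.ξ 0 + L.ξ 1)) - L.ηb Y • L.f (L.A 0 X) := by
  have h1 : ∀ Y, L.dl L.f X Y = L.dl L.f (- L.f (L.f X)) Y := fun Y ↦ by
    conv_lhs => rw [L.decomp X]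
    simp only [L.dl_add_left, L.dl_smul_left, hk.dl_f_ξ, smul_zero, add_zero]
  have h2 : L.A 0 X = L.A 0 (- L.f (L.f X)) := by
    conv_lhs => rw [L.decomp X]
    simp [A_ξ]
  have h3 : ∀ Y, L.IsHor Y →
      L.dl L.f X Y = -(L.g (L.f Y) (L.A 0 X) • (L.ξ 0 + L.ξ 1)) := fun Y hY ↦ by
    refine L.ext_g fun Z ↦ ?_
    have e : ∀ α, L.g (L.dl L.f X Y) (L.ξ α) = - L.g (L.f Y) (L.A 0 X) := fun α ↦ by
      rw [L.dl_skew L.f_skew, dl_f_ξ_right hB, L.f_skew, map_neg]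
    conv_lhs => rw [L.decomp Z]
    rw [map_add, map_add, map_smul, map_smul, e, e, h1, H _ _ _ (isHor_neg_f_f X) hY
      (isHor_neg_f_f Z)]
    simp only [map_neg, map_smul, map_add, LinearMap.neg_apply, LinearMap.smul_apply,
      LinearMap.add_apply, smul_eq_mul]
    ring
  conv_lhs => rw [L.decomp Y]
  simp only [L.dl_add_right, L.dl_smul_right, dl_f_ξ_right hB, h3 _ (isHor_neg_f_f Y), map_neg,
    f_f_f, neg_neg, FContactAlgebra.ηb]
  module

lemma Nullity.nab_f (hk : L.Nullity k) (hB : ∀ α, L.B α = L.B 0)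
    (H : ∀ X Y Z, L.IsHor X → L.IsHor Y → L.IsHor Z → L.g (L.dl L.f X Y) Z = 0) (X Y : V) :
    L.nab X (L.f Y) = L.f (L.nab X Y) - L.g (L.f Y) (L.A 0 X) • (L.ξ 0 + L.ξ 1)
      - L.ηb Y • L.f (L.A 0 X) := by
  have h := hk.dl_f_eq hB H X Y
  rw [LCAlgebra.dl] at h
  linear_combination (norm := module) h

/-- The structure is normal when all `B_α` vanish. -/
lemma Nullity.normal (hk : L.Nullity k) (hB : ∀ α, L.B α = 0) (X Y : V) :
    L.f (L.f (L.brk X Y)) + L.brk (L.f X) (L.f Y) - L.f (L.brk (L.f X) Y) - L.f (L.brk X (L.f Y))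
      + (2 : R) • (L.g X (L.f Y) • L.ξ 0 + L.g X (L.f Y) • L.ξ 1) = 0 := by
  have hA : ∀ U, L.A 0 U = - L.f U := fun U ↦ by rw [A_eq, hB]; simp
  have N := hk.nab_f (fun α ↦ by rw [hB, hB]) fun X Y Z ↦ hk.dl_f_of_B_eq_zero (hB 0)
  have e : L.g Y (L.f X) = - L.g X (L.f Y) := by rw [L.g_symm, L.f_skew]
  simp only [LCAlgebra.brk, map_sub, N, map_add, map_smul, L.f_ξ, hA, map_neg, f_f_f, L.f_skew, e]
  module

/-- Differentiate $\eta_\alpha(Z)=0$; the factor $2$ counts the two structure fields, which share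
the same $A$. -/
lemma ηb_nab (hB : ∀ α, L.B α = L.B 0) {Z : V} (hZ : L.IsHor Z) (Y : V) :
    L.ηb (L.nab Y Z) = - (2 * L.g (L.A 0 Y) Z) := by
  have e : ∀ α, L.g (L.ξ α) (L.nab Y Z) = - L.g (L.A 0 Y) Z := fun α ↦ by
    have h := L.metric Y (L.ξ α) Z
    have : L.A α Y = L.A 0 Y := by rw [A_eq, A_eq, hB]
    rw [hZ α, L.D_zero, ← A_def, this] at h
    linear_combination -h
  rw [FContactAlgebra.ηb, e, e]; ring

/-- The commutator of curvature and `f`. -/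
lemma Nullity.Rm_f (hk : L.Nullity k) (hB : ∀ α, L.B α = L.B 0)
    (H : ∀ X Y Z, L.IsHor X → L.IsHor Y → L.IsHor Z → L.g (L.dl L.f X Y) Z = 0) (X Y : V)
    {Z W : V} (hZ : L.IsHor Z) (hW : L.IsHor W) :
    L.g (L.Rm X Y (L.f Z)) W - L.g (L.f (L.Rm X Y Z)) W =
      2 * L.g (L.A 0 Y) Z * L.g (L.f (L.A 0 X)) W - 2 * L.g (L.A 0 X) Z * L.g (L.f (L.A 0 Y)) W
      - 2 * L.g (L.f Z) (L.A 0 Y) * L.g (L.A 0 X) W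
      + 2 * L.g (L.f Z) (L.A 0 X) * L.g (L.A 0 Y) W := by
  have N := hk.nab_f hB H
  have e : ∀ α X, L.nab X (L.ξ α) = L.A 0 X := fun α X ↦ by rw [← A_def, A_eq, A_eq, hB]
  -- No derivative of $A$ survives: its coefficient $\bar\eta(Z)$ is zero, and the derivatives of
  -- scalar coefficients multiply $\xi_0+\xi_1$, which is orthogonal to $W$.
  simp only [LCAlgebra.Rm, N, L.nab_sub, L.nab_smul, L.nab_add, hZ.ηb, ηb_nab hB hZ, e, map_sub,
    map_add, map_smul, LinearMap.sub_apply, LinearMap.add_apply, LinearMap.smul_apply, hW 0, hW 1,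
    smul_eq_mul, zero_smul, map_zero, L.nab_zero]
  simp only [LinearMap.zero_apply]
  ring

/-- Two `l`-eigenfields of `B ∘ f` cannot be independent when the horizontal curvature is of
generalized space form type. -/
lemma Nullity.gram_eq_zero (hk : L.Nullity k) (hl : IsUnit l) (hl1 : IsUnit (1 + l))
    (hD : ∀ X, L.D X l = 0) (hkl : l * l = 1 - k) {F₁ F₂ : R}
    (hF : ∀ X Y Z, L.IsHor X → L.IsHor Y → L.IsHor Z →
      L.Rm X Y Z = F₁ • (L.g Y Z • X - L.g X Z • Y)
        + F₂ • (L.g X (L.f Z) • L.f Y - L.g Y (L.f Z) • L.f X + (2 * L.g X (L.f Y)) • L.f Z))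
    {X Y : V} (hX : L.IsPlus l X) (hY : L.IsPlus l Y) :
    L.g X X * L.g Y Y - L.g X Y * L.g X Y = 0 := by
  have hu : IsUnit (1 - k) := by rw [← hkl]; exact hl.mul hl
  have hB : ∀ α, L.B α = L.B 0 := fun α ↦ hk.B_eq hu α 0
  have hRf := hk.Rm_f hB fun X Y Z ↦ hk.dl_f_of_plus hl hl1 hD hkl
  -- Of the two commutator identities, the space-form formula evaluates the left sides to
  -- $(F_2-F_1)G$ and $(F_1-F_2)G$, where $G$ is the Gram determinant. The right sides are
  -- $-2(1+l)^2G$ and $2(1-l)^2G$, so adding gives $8lG=0$.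
  have p := hRf X Y hY.1 (L.isHor_f X)
  have m := hRf (L.f X) (L.f Y) (L.isHor_f Y) hX.1
  rw [hF _ _ _ hX.1 hY.1 hY.1, hF _ _ _ hX.1 hY.1 (L.isHor_f Y)] at p
  rw [hF _ _ _ (L.isHor_f X) (L.isHor_f Y) (L.isHor_f Y),
    hF _ _ _ (L.isHor_f X) (L.isHor_f Y) (L.isHor_f _)] at m
  have gyx : L.g Y X = L.g X Y := L.g_symm _ _
  have gfl : ∀ {U W}, L.IsPlus l U → L.IsPlus l W → L.g (L.f U) W = 0 := fun hU hW ↦ by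
    rw [L.g_symm]; exact hW.g_f hk hl hU
  simp only [hX.A_apply hk, hY.A_apply hk, hX.A_f, hY.A_f, hX.1.f_sq, hY.1.f_sq, map_sub, map_add,
    map_smul, map_neg, LinearMap.sub_apply, LinearMap.add_apply, LinearMap.smul_apply,
    LinearMap.neg_apply, smul_eq_mul, hX.g_f_f, hY.g_f_f, hX.g_f hk hl hY, hY.g_f hk hl hX,
    hX.g_f hk hl hX, hY.g_f hk hl hY, gfl hX hX, gfl hX hY, gfl hY hX, gfl hY hY, gyx] at p m
  have h8 : 2 * (2 * (2 * (l * (L.g X X * L.g Y Y - L.g X Y * L.g X Y)))) = 0 := by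
    linear_combination p + m
  have h := L.cancel_two (L.cancel_two (L.cancel_two h8))
  obtain ⟨u, rfl⟩ := hl
  exact (Units.mul_right_eq_zero u).1 h

end FContactAlgebra

/-! ### Removing the $h_\alpha$-terms from the nullity condition -/

namespace FContactAlgebra
variable {R V : Type*} [CommRing R] [AddCommGroup V] [Module R V] {L : FContactAlgebra R V}
variable {k m : R}

variable (L) in
/-- The Lie derivative `L_{ξ_α} f`, which is twice the operator `h_α`. -/
def lieF (α : Fin 2) (X : V) : V := L.brk (L.ξ α) (L.f X) - L.f (L.brk (L.ξ α) X)

lemma lieF_add (α : Fin 2) (X Y : V) : L.lieF α (X + Y) = L.lieF α X + L.lieF α Y := by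
  simp only [lieF, map_add, brk_add]; module

lemma lieF_smul (α : Fin 2) (a : R) (X : V) : L.lieF α (a • X) = a • L.lieF α X := by
  simp only [lieF, map_smul, brk_smul, map_add]; module

lemma lieF_ξ (α β : Fin 2) : L.lieF α (L.ξ β) = 0 := by
  have : L.brk (L.ξ α) 0 = 0 := by simp [LCAlgebra.brk, L.nab_zero]
  rw [lieF, L.f_ξ, this, L.brk_ξ, map_zero, sub_zero]

/-- Flowing along $\xi_\alpha$ preserves the horizontal distribution, on which $f^2=-1$. -/
lemma lieF_f (α : Fin 2) {X : V} (hX : L.IsHor X) : L.lieF α (L.f X) = - L.f (L.lieF α X) := by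
  have h : L.IsHor (L.brk (L.ξ α) X) := fun β ↦ by rw [← D_ξ, hX β, L.D_zero]
  have e : L.brk (L.ξ α) (-X) = - L.brk (L.ξ α) X := by
    simp only [LCAlgebra.brk, L.nab_neg, L.nab_neg_left]; module
  simp only [lieF, hX.f_sq, e, map_sub, h.f_sq]; module

/-- The `h_α`-terms of the `(κ, μ)`-nullity condition drop out when the curvature operators
`R(·, ξ_α)ξ_α` are scalar on horizontal fields. -/
lemma nullity_of_scalar (hn : ∀ α X Y, L.Rm X Y (L.ξ α) =
      k • (L.ηb X • L.f (L.f Y) - L.ηb Y • L.f (L.f X))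
        + m • (L.ηb Y • L.lieF α X - L.ηb X • L.lieF α Y))
    (c : Fin 2 → R) (hc : ∀ α X, L.IsHor X → L.Rm X (L.ξ α) (L.ξ α) = c α • X) :
    L.Nullity k := by
  have key : ∀ α X, L.IsHor X → m • L.lieF α X = (c α - k) • X := fun α X hX ↦ by
    have h := hn α X (L.ξ α)
    rw [hc α X hX, hX.ηb, L.ηb_ξ, hX.f_sq] at h
    linear_combination (norm := module) -h
  -- A scalar operator commutes with $f$, whereas $L_{\xi_\alpha}f$ anticommutes with it on
  -- horizontal fields; so the scalar is zero there.
  have key0 : ∀ α X, L.IsHor X → m • L.lieF α X = 0 := fun α X hX ↦ by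
    have h1 := key α (L.f X) (L.isHor_f X)
    have h2 := congrArg L.f (key α X hX)
    rw [lieF_f α hX] at h1
    rw [map_smul, map_smul] at h2
    have h3 : (c α - k) • L.f X = 0 := L.cancel_two_smul (by
      linear_combination (norm := module) -h1 - h2)
    have h4 := congrArg L.f h3
    rw [map_smul, hX.f_sq, map_zero] at h4
    rw [key α X hX]
    linear_combination (norm := module) -h4
  have key1 : ∀ α X, m • L.lieF α X = 0 := fun α X ↦ by
    rw [L.decomp X, lieF_add, lieF_add, lieF_smul, lieF_smul, lieF_ξ, lieF_ξ, smul_add,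
      key0 α _ (isHor_neg_f_f X)]
    simp
  intro α X Y
  rw [hn, smul_sub m, smul_comm m, smul_comm m, key1, key1]
  module

end FContactAlgebra

/-! ### Smoothness of brackets and covariant derivatives -/

namespace FGeom
section Smoothness

lemma contMDiffAt_det {E : Type*} [NormedAddCommGroup E] [NormedSpace ℝ E]
    {M : Type*} [TopologicalSpace M] [ChartedSpace E M] {ι : Type*} [Fintype ι] [DecidableEq ι]
    {A : M → Matrix ι ι ℝ} {x : M}
    (h : ∀ i j, CMDiffAt ∞ (fun y ↦ A y i j) x) : CMDiffAt ∞ (fun y ↦ (A y).det) x := by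
  simp only [Matrix.det_apply']
  exact contMDiffAt_finsetSum fun σ _ ↦
    contMDiffAt_const.mul (contMDiffAt_finsetProd fun i _ ↦ h _ _)

variable {E : Type*} [NormedAddCommGroup E] [NormedSpace ℝ E]
  {M : Type*} [TopologicalSpace M] [ChartedSpace E M] [IsManifold 𝓘(ℝ, E) ∞ M]
  (g : RiemMetric E M)

lemma isManifold_minSmoothness (E : Type*) [NormedAddCommGroup E] [NormedSpace ℝ E] (M : Type*)
    [TopologicalSpace M] [ChartedSpace E M] [IsManifold 𝓘(ℝ, E) ∞ M] (k : ℕ) :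
    IsManifold 𝓘(ℝ, E) (minSmoothness ℝ k) M := by
  rw [minSmoothness_of_isRCLikeNormedField]
  exact .of_le (n := ∞) (mod_cast le_top)

lemma contMDiffAt_pair {X Y : VField E M} {x : M} (hX : CMDiffAt ∞ (T% X) x)
    (hY : CMDiffAt ∞ (T% Y) x) : CMDiffAt ∞ (pair g X Y) x := by
  have : ContMDiffAt 𝓘(ℝ, E) (𝓘(ℝ, E).prod 𝓘(ℝ)) ∞
      (fun m ↦ TotalSpace.mk' ℝ (E := Bundle.Trivial M ℝ) m (g.inner m (X m) (Y m))) x := by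
    apply ContMDiffAt.clm_bundle_apply₂ (F₁ := E) (F₂ := E)
    · exact g.contMDiff x
    · exact hX
    · exact hY
  simp only [contMDiffAt_totalSpace] at this
  exact this.2

lemma contMDiff_d {r : M → ℝ} (hr : CMDiff ∞ r) {X : VField E M} (hX : CMDiff ∞ (T% X)) :
    CMDiff ∞ (fun x ↦ d% r x (X x)) := by
  have h := (hr.contMDiff_tangentMap (m := ∞) (by simp)).comp hX
  intro x
  have hx := (contMDiffAt_totalSpace.1 (h x)).2
  simpa using! hx

lemma contMDiff_brk [FiniteDimensional ℝ E] {X Y : VField E M} (hX : CMDiff ∞ (T% X))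
    (hY : CMDiff ∞ (T% Y)) : CMDiff ∞ (T% (brk X Y)) := by
  have := FiniteDimensional.complete ℝ E
  have : IsManifold 𝓘(ℝ, E) ((⊤ : ℕ∞) + 1) M := by simpa
  have : IsManifold 𝓘(ℝ, E) (minSmoothness ℝ 2) M := isManifold_minSmoothness E M 2
  intro x
  exact ContMDiffAt.mlieBracket_vectorField (m := ⊤) (n := ⊤) (hX x) (hY x) (by simp)

/-- Near every point there is a local frame of globally defined smooth vector fields. -/
lemma exists_global_frame [FiniteDimensional ℝ E] [T2Space M] (x : M) :
    ∃ (s : Module.Basis.ofVectorSpaceIndex ℝ E → VField E M), (∀ i, CMDiff ∞ (T% (s i))) ∧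
      ∃ u ∈ nhds x, IsLocalFrameOn 𝓘(ℝ, E) E ∞ s u := by
  let e := trivializationAt E (TangentSpace 𝓘(ℝ, E) : M → Type _) x
  let b := Module.Basis.ofVectorSpace ℝ E
  have hx : x ∈ e.baseSet := FiberBundle.mem_baseSet_trivializationAt' x
  obtain ⟨ψ, -, hψ⟩ := (SmoothBumpFunction.nhds_basis_tsupport (I := 𝓘(ℝ, E)) x).mem_iff.1
    (e.open_baseSet.mem_nhds hx)
  have hs : ∀ i, CMDiff ∞ (T% (fun y ↦ ψ y • e.localFrame b i y)) := fun i ↦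
    ContMDiffOn.smul_section_of_tsupport ψ.contMDiff.contMDiffOn e.open_baseSet hψ
      (e.contMDiffOn_localFrame_baseSet _ b i)
  refine ⟨fun i y ↦ ψ y • e.localFrame b i y, hs, {y | ψ y = 1} ∩ e.baseSet,
    Filter.inter_mem ψ.eventuallyEq_one (e.open_baseSet.mem_nhds hx), ?_⟩
  refine ((e.isLocalFrameOn_localFrame_baseSet 𝓘(ℝ, E) ∞ b).mono Set.inter_subset_right).congr ?_
  rintro i y ⟨hy, -⟩
  have : ψ y = 1 := hy
  simp [this]

lemma exists_extension [FiniteDimensional ℝ E] [T2Space M] {x : M} (v : TangentSpace 𝓘(ℝ, E) x) :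
    ∃ X : VField E M, CMDiff ∞ (T% X) ∧ X x = v := by
  obtain ⟨s, hs, u, hu, hf⟩ := exists_global_frame (E := E) x
  have hx : x ∈ u := mem_of_mem_nhds hu
  have : Fintype (Module.Basis.ofVectorSpaceIndex ℝ E) := Fintype.ofFinite _
  refine ⟨fun y ↦ ∑ i, (hf.toBasisAt hx).repr v i • s i y, ?_, ?_⟩
  · exact ContMDiff.sum_section fun i _ ↦ (hs i).const_smul_section
  · simpa using (hf.toBasisAt hx).sum_repr v

variable {g} in
/-- A vector field whose inner products with all smooth fields are smooth is smooth. -/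
lemma contMDiff_of_pair [FiniteDimensional ℝ E] [T2Space M] {U : VField E M}
    (h : ∀ Z : VField E M, CMDiff ∞ (T% Z) → CMDiff ∞ (pair g U Z)) : CMDiff ∞ (T% U) := by
  classical
  intro x
  obtain ⟨s, hs, u, hu, hf⟩ := exists_global_frame (E := E) x
  have : Fintype (Module.Basis.ofVectorSpaceIndex ℝ E) := Fintype.ofFinite _
  -- The Gram matrix of the frame is invertible on `u`, so by Cramer's rule the coefficients of `U`
  -- are quotients of smooth determinants.
  let G : M → Matrix _ _ ℝ := fun y ↦ Matrix.of fun i j ↦ pair g (s i) (s j) y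
  have hG : ∀ i j, CMDiffAt ∞ (fun y ↦ G y i j) x := fun i j ↦
    contMDiffAt_pair g (hs i x) (hs j x)
  let c : M → Module.Basis.ofVectorSpaceIndex ℝ E → ℝ := fun y i ↦ hf.coeff i y (U y)
  let b : M → Module.Basis.ofVectorSpaceIndex ℝ E → ℝ := fun y j ↦ pair g U (s j) y
  have hGc : ∀ y ∈ u, (G y).mulVec (c y) = b y := by
    intro y hy
    ext j
    have e := hf.coeff_sum_eq U hy
    simp only [b, pair, Matrix.mulVec, dotProduct, G, Matrix.of_apply, c]
    conv_rhs => rw [e]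
    rw [map_sum, sum_apply]
    refine Finset.sum_congr rfl fun i _ ↦ ?_
    rw [map_smul, smul_apply, smul_eq_mul, mul_comm, g.symm]
  have hdet : ∀ y ∈ u, (G y).det ≠ 0 := by
    intro y hy h0
    obtain ⟨v, hv, hv0⟩ := Matrix.exists_mulVec_eq_zero_iff.2 h0
    apply hv
    have hz : ∀ j, g.inner y (∑ i, v i • s i y) (s j y) = 0 := by
      intro j
      have := congrFun hv0 j
      simp only [Matrix.mulVec, dotProduct, G, Matrix.of_apply, pair, Pi.zero_apply] at this
      rw [← this, map_sum, sum_apply]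
      refine Finset.sum_congr rfl fun i _ ↦ ?_
      rw [map_smul, smul_apply, smul_eq_mul, mul_comm, g.symm]
    have hw : ∑ i, v i • s i y = 0 := by
      by_contra hne
      refine (g.pos y _ hne).ne' ?_
      rw [map_sum]
      exact Finset.sum_eq_zero fun i _ ↦ by rw [map_smul, hz, smul_zero]
    have := Fintype.linearIndependent_iff.1 (hf.linearIndependent hy) v hw
    exact funext this
  refine hf.contMDiffAt_of_coeff (fun i ↦ ?_) hu
  have hc : ∀ y ∈ u, c y i = ((G y).updateCol i (b y)).det / (G y).det := by
    intro y hy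
    rw [← hGc y hy, ← Matrix.cramer_apply, Matrix.cramer_eq_adjugate_mulVec, Matrix.mulVec_mulVec,
      Matrix.adjugate_mul, Matrix.smul_mulVec, Matrix.one_mulVec, Pi.smul_apply, smul_eq_mul,
      mul_div_cancel_left₀ _ (hdet y hy)]
  have hsm : CMDiffAt ∞ (fun y ↦ ((G y).updateCol i (b y)).det / (G y).det) x := by
    refine ContMDiffAt.div₀ (contMDiffAt_det fun k j ↦ ?_) (contMDiffAt_det hG)
      (hdet x (mem_of_mem_nhds hu))
    simp only [Matrix.updateCol_apply]
    split_ifs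
    · exact h _ (hs k) x
    · exact hG k j
  exact hsm.congr_of_eventuallyEq (Filter.eventually_of_mem hu fun y hy ↦ hc y hy)

/-- The Koszul expression is smooth in the base point for smooth fields, so all pairings of
$\nabla_XY$ are smooth. -/
lemma contMDiff_nabla [FiniteDimensional ℝ E] [T2Space M] {X Y : VField E M}
    (hX : CMDiff ∞ (T% X)) (hY : CMDiff ∞ (T% Y)) :
    CMDiff ∞ (T% (fun x ↦ leviCivita g Y x (X x))) := by
  refine contMDiff_of_pair (g := g) fun Z hZ ↦ ?_
  have md : ∀ {W : VField E M}, CMDiff ∞ (T% W) → ∀ x, MDiffAt (T% W) x := fun hW x ↦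
    (hW x).mdifferentiableAt (by simp)
  have e : pair g (fun x ↦ leviCivita g Y x (X x)) Z = fun x ↦ (1 / 2 : ℝ) * koszul g X Y Z x := by
    ext x
    rw [← inner_nabla g (md hX x) (md hY x) (md hZ x)]
    simp only [pair]
    change g.inner x (nabla g Y x (X x)) (Z x) = _
    ring
  have P : ∀ {W W' : VField E M}, CMDiff ∞ (T% W) → CMDiff ∞ (T% W') → CMDiff ∞ (pair g W W') :=
    fun h h' x ↦ contMDiffAt_pair g (h x) (h' x)
  rw [e]
  have K : CMDiff ∞ (koszul g X Y Z) := (((((contMDiff_d (P hY hZ) hX).add (contMDiff_d (P hX hZ) hY)).sub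
    (contMDiff_d (P hX hY) hZ)).add (P (contMDiff_brk hX hY) hZ)).sub
    (P (contMDiff_brk hX hZ) hY)).sub (P (contMDiff_brk hY hZ) hX)
  exact contMDiff_const.mul K

end Smoothness
end FGeom

/-! ### Smooth functions and fields as an instance of the algebraic model -/

namespace FGeom
noncomputable section
section SmoothAlgebra

variable (E : Type*) [NormedAddCommGroup E] [NormedSpace ℝ E]
  (M : Type*) [TopologicalSpace M] [ChartedSpace E M]

/-- Smooth functions on `M`. -/
abbrev SmoothFn := C^∞⟮𝓘(ℝ, E), M; 𝓘(ℝ), ℝ⟯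

variable {E M}

@[simp]
lemma SmoothFn.add_apply (a b : SmoothFn E M) (x : M) : (a + b) x = a x + b x := rfl

@[simp]
lemma SmoothFn.sub_apply (a b : SmoothFn E M) (x : M) : (a - b) x = a x - b x := rfl

@[simp]
lemma SmoothFn.mul_apply (a b : SmoothFn E M) (x : M) : (a * b) x = a x * b x := rfl

@[simp]
lemma SmoothFn.one_apply (x : M) : (1 : SmoothFn E M) x = 1 := rfl

@[simp]
lemma SmoothFn.zero_apply (x : M) : (0 : SmoothFn E M) x = 0 := rfl

@[simp]
lemma SmoothFn.two_apply (x : M) : (2 : SmoothFn E M) x = 2 := by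
  rw [← one_add_one_eq_two, SmoothFn.add_apply, SmoothFn.one_apply]; norm_num

@[simp]
lemma SmoothFn.algebraMap_apply (c : ℝ) (x : M) : algebraMap ℝ (SmoothFn E M) c x = c := rfl

lemma SmoothFn.mdiff (a : SmoothFn E M) (x : M) : MDiffAt a x :=
  a.mdifferentiableAt

variable (E M) [IsManifold 𝓘(ℝ, E) ∞ M]

/-- Smooth vector fields on `M`. -/
abbrev SmoothVF := Cₛ^∞⟮𝓘(ℝ, E); E, (fun x : M ↦ TangentSpace 𝓘(ℝ, E) x)⟯

variable {E M}

instance : SMul (SmoothFn E M) (SmoothVF E M) :=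
  ⟨fun a X ↦ ⟨fun x ↦ a x • X x, a.contMDiff.smul_section X.contMDiff⟩⟩

@[simp]
lemma SmoothVF.smul_apply (a : SmoothFn E M) (X : SmoothVF E M) (x : M) :
    (a • X) x = a x • X x := rfl

@[simp]
lemma SmoothVF.add_apply (X Y : SmoothVF E M) (x : M) : (X + Y) x = X x + Y x := rfl

@[simp]
lemma SmoothVF.sub_apply (X Y : SmoothVF E M) (x : M) : (X - Y) x = X x - Y x := rfl

instance : Module (SmoothFn E M) (SmoothVF E M) where
  one_smul X := by ext x; simp
  mul_smul a b X := by ext x; simp [mul_smul]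
  smul_zero a := by ext x; simp
  smul_add a X Y := by ext x; simp
  add_smul a b X := by ext x; simp [add_smul]
  zero_smul X := by ext x; simp

lemma SmoothVF.mdiff (X : SmoothVF E M) (x : M) : MDiffAt (T% (fun y ↦ X y)) x :=
  X.mdifferentiableAt

variable [FiniteDimensional ℝ E] [T2Space M]

/-- The Lie bracket of smooth vector fields. -/
def smoothBrk (X Y : SmoothVF E M) : SmoothVF E M :=
  ⟨brk X Y, contMDiff_brk X.contMDiff Y.contMDiff⟩

/-- The covariant derivative of smooth vector fields. -/
def smoothNab (g : RiemMetric E M) (X Y : SmoothVF E M) : SmoothVF E M :=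
  ⟨fun x ↦ leviCivita g Y x (X x), contMDiff_nabla g X.contMDiff Y.contMDiff⟩

lemma smoothNab_sub (g : RiemMetric E M) (X Y : SmoothVF E M) :
    smoothNab g X Y - smoothNab g Y X = smoothBrk X Y := by
  ext x
  exact leviCivita_torsionFree g (X.mdiff x) (Y.mdiff x)

/-- The Levi-Civita calculus of smooth vector fields. -/
def lcAlgebra (g : RiemMetric E M) : LCAlgebra (SmoothFn E M) (SmoothVF E M) where
  g := LinearMap.mk₂ _ (fun X Y ↦ ⟨pair g X Y, fun x ↦ contMDiffAt_pair g (X.contMDiff x)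
      (Y.contMDiff x)⟩)
    (fun X X' Y ↦ by ext x; exact congrFun (pair_add_left g X X' Y) x)
    (fun a X Y ↦ by ext x; exact congrFun (pair_smul_left g a X Y) x)
    (fun X Y Y' ↦ by ext x; exact congrFun (pair_add_right g X Y Y') x)
    (fun a X Y ↦ by ext x; exact congrFun (pair_smul_right g a X Y) x)
  g_symm X Y := by ext x; exact g.symm x _ _
  g_nondeg X h := by
    ext x
    by_contra hx
    exact (g.pos x (X x) hx).ne' (DFunLike.congr_fun (h X) x)
  two_unit := by
    have := (IsUnit.mk0 (2 : ℝ) two_ne_zero).map (algebraMap ℝ (SmoothFn E M))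
    rwa [map_ofNat] at this
  D X a := ⟨fun x ↦ d% a x (X x), contMDiff_d a.contMDiff X.contMDiff⟩
  D_mul X a b := by
    ext x
    change d% (⇑a * ⇑b) x (X x) = d% a x (X x) * b x + a x * d% b x (X x)
    rw [mvfderiv_mul (a.mdiff x) (b.mdiff x)]
    simp; ring
  D_add X a b := by
    ext x
    change d% (⇑a + ⇑b) x (X x) = d% a x (X x) + d% b x (X x)
    rw [mvfderiv_add (a.mdiff x) (b.mdiff x)]
    simp
  nab :=
    { toFun := smoothNab g
      map_add' := fun X X' ↦ by
        funext Y; ext x; exact map_add (leviCivita g Y x) (X x) (X' x)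
      map_smul' := fun a X ↦ by
        funext Y; ext x; exact map_smul (leviCivita g Y x) (a x) (X x) }
  nab_add X Y Z := by
    ext x
    have := (leviCivita g).isCovariantDerivativeOnUniv.add (Y.mdiff x) (Z.mdiff x)
    exact DFunLike.congr_fun this (X x)
  nab_smul X a Y := by
    ext x
    have := (leviCivita g).isCovariantDerivativeOnUniv.leibniz (Y.mdiff x) (a.mdiff x)
    have := DFunLike.congr_fun this (X x)
    rw [add_comm]
    exact this
  metric X Y Z := by
    ext x
    exact leviCivita_metric g (X.mdiff x) (Y.mdiff x) (Z.mdiff x)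
  jacobi X Y Z := by
    have := FiniteDimensional.complete ℝ E
    have := isManifold_minSmoothness E M 3
    change smoothNab g X (smoothNab g Y Z - smoothNab g Z Y)
        - smoothNab g (smoothNab g Y Z - smoothNab g Z Y) X
      = (smoothNab g (smoothNab g X Y - smoothNab g Y X) Z
          - smoothNab g Z (smoothNab g X Y - smoothNab g Y X))
        + (smoothNab g Y (smoothNab g X Z - smoothNab g Z X)
          - smoothNab g (smoothNab g X Z - smoothNab g Z X) Y)
    simp only [smoothNab_sub]
    have h2 : minSmoothness ℝ 2 ≤ ∞ := by
      rw [minSmoothness_of_isRCLikeNormedField]; exact WithTop.coe_le_coe.2 le_top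
    ext x
    exact leibniz_identity_mlieBracket_apply ((X.contMDiff x).of_le h2)
      ((Y.contMDiff x).of_le h2) ((Z.contMDiff x).of_le h2)

end SmoothAlgebra

section FContact

variable {E : Type*} [NormedAddCommGroup E] [NormedSpace ℝ E]
  {M : Type*} [TopologicalSpace M] [ChartedSpace E M] [IsManifold 𝓘(ℝ, E) ∞ M]
  {n : ℕ} (S : MetricFStructure E M n 2)

lemma MetricFStructure.η_eq (α : Fin 2) (x : M) (v : TangentSpace 𝓘(ℝ, E) x) :
    S.η α x v = S.g.inner x (S.ξ α x) v := by
  have h := S.g_f x v (S.ξ α x)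
  rw [S.f_ξ, map_zero, S.g.symm x v] at h
  simp only [S.η_ξ] at h
  simp at h
  linarith

lemma MetricFStructure.contMDiff_fApply {X : VField E M} (hX : CMDiff ∞ (T% X)) :
    CMDiff ∞ (T% (S.fApply X)) := fun x ↦
  ContMDiffAt.clm_bundle_apply (S.smooth_f x) (hX x)

variable [FiniteDimensional ℝ E] [T2Space M]

/-- The calculus of smooth vector fields on a metric `f`-contact manifold. -/
def fContactAlgebra (hS : S.IsFContact) : FContactAlgebra (SmoothFn E M) (SmoothVF E M) where
  toLCAlgebra := lcAlgebra S.g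
  f :=
    { toFun := fun X ↦ ⟨S.fApply X, S.contMDiff_fApply X.contMDiff⟩
      map_add' := fun X Y ↦ by ext x; exact map_add (S.f x) (X x) (Y x)
      map_smul' := fun a X ↦ by ext x; exact map_smul (S.f x) (a x) (X x) }
  ξ α := ⟨S.ξ α, S.smooth_ξ α⟩
  f_skew X Y := by
    ext x
    change S.g.inner x (S.f x (X x)) (Y x) = - S.g.inner x (X x) (S.f x (Y x))
    have h1 := S.g_f x (X x) (S.f x (Y x))
    simp only [S.f_sq, S.η_f, map_add, map_neg, map_sum, map_smul] at h1
    have h2 : ∀ α, S.g.inner x (S.f x (X x)) (S.ξ α x) = 0 := fun α ↦ by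
      rw [S.g.symm, ← S.η_eq, S.η_f]
    simp [h2] at h1
    linarith
  f_ξ α := by ext x; exact S.f_ξ α x
  f_sq X := by
    ext x
    have h := S.f_sq x (X x)
    rw [Fin.sum_univ_two, S.η_eq, S.η_eq, ← add_assoc] at h
    exact h
  ξ_ξ α β := by
    ext x
    have h := S.η_ξ α β x
    rw [S.η_eq] at h
    refine h.trans ?_
    split_ifs <;> rfl
  contact α X Y := by
    ext x
    have h := hS α X Y X.contMDiff Y.contMDiff x
    have e : ∀ Z : VField E M, S.ηApply α Z = pair S.g (S.ξ α) Z := fun Z ↦ by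
      ext y; exact S.η_eq α y (Z y)
    rw [MetricFStructure.dη, e, e, e] at h
    change d% (pair S.g (S.ξ α) Y) x (X x) - d% (pair S.g (S.ξ α) X) x (Y x)
      - pair S.g (S.ξ α) (⇑(smoothNab S.g X Y - smoothNab S.g Y X)) x
        = (2 : SmoothFn E M) x * pair S.g X (S.fApply Y) x
    rw [smoothNab_sub, SmoothFn.two_apply, h]
    change _ - _ - pair S.g (S.ξ α) (brk X Y) x = _
    ring

end FContact
end
end FGeom

/-! ### Back to the manifold: $\kappa=1$ and normality -/

namespace FGeom
section SpaceForms

variable {E : Type*} [NormedAddCommGroup E] [NormedSpace ℝ E] [FiniteDimensional ℝ E]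
  {M : Type*} [TopologicalSpace M] [T2Space M] [ChartedSpace E M] [IsManifold 𝓘(ℝ, E) ∞ M]
  {n : ℕ} {S : MetricFStructure E M n 2} (hS : S.IsFContact)

lemma fContactAlgebra_brk (X Y : SmoothVF E M) :
    (fContactAlgebra S hS).brk X Y = smoothBrk X Y := smoothNab_sub S.g X Y

lemma fContactAlgebra_Rm (X Y Z : SmoothVF E M) (x : M) :
    (fContactAlgebra S hS).Rm X Y Z x = curvature S.g X Y Z x := by
  rw [LCAlgebra.Rm, fContactAlgebra_brk]; rfl

lemma fContactAlgebra_g (X Y : SmoothVF E M) (x : M) :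
    (fContactAlgebra S hS).g X Y x = S.g.inner x (X x) (Y x) := rfl

lemma fContactAlgebra_f (X : SmoothVF E M) (x : M) :
    (fContactAlgebra S hS).f X x = S.f x (X x) := rfl

lemma fContactAlgebra_η (α : Fin 2) (X : SmoothVF E M) (x : M) :
    S.ηApply α X x = (fContactAlgebra S hS).g ((fContactAlgebra S hS).ξ α) X x :=
  S.η_eq α x (X x)

lemma fContactAlgebra_ηb (X : SmoothVF E M) (x : M) :
    S.ηBar X x = (fContactAlgebra S hS).ηb X x := by
  rw [MetricFStructure.ηBar, Fin.sum_univ_two, fContactAlgebra_η hS, fContactAlgebra_η hS]; rfl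

lemma fContactAlgebra_h (α : Fin 2) (X : SmoothVF E M) (x : M) :
    S.h α X x = (1 / 2 : ℝ) • (fContactAlgebra S hS).lieF α X x := by
  rw [FContactAlgebra.lieF, fContactAlgebra_brk, fContactAlgebra_brk]; rfl

/-- The two consequences of the space-form formula that the argument uses: the curvature on
horizontal fields, and scalar operators $R(\cdot,\xi_\alpha)\xi_\alpha$. -/
lemma exists_horizontal_form (hgen : S.IsGeneralizedSSpaceForm) :
    (∃ F₁ F₂ : SmoothFn E M, ∀ X Y Z : SmoothVF E M, (fContactAlgebra S hS).IsHor X →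
      (fContactAlgebra S hS).IsHor Y → (fContactAlgebra S hS).IsHor Z →
      (fContactAlgebra S hS).Rm X Y Z = F₁ • ((fContactAlgebra S hS).g Y Z • X
          - (fContactAlgebra S hS).g X Z • Y)
        + F₂ • ((fContactAlgebra S hS).g X ((fContactAlgebra S hS).f Z) • (fContactAlgebra S hS).f Y
          - (fContactAlgebra S hS).g Y ((fContactAlgebra S hS).f Z) • (fContactAlgebra S hS).f X
          + (2 * (fContactAlgebra S hS).g X ((fContactAlgebra S hS).f Y))
            • (fContactAlgebra S hS).f Z)) ∧
    ∃ c : Fin 2 → SmoothFn E M, ∀ α X, (fContactAlgebra S hS).IsHor X →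
      (fContactAlgebra S hS).Rm X ((fContactAlgebra S hS).ξ α) ((fContactAlgebra S hS).ξ α)
        = c α • X := by
  obtain ⟨F₁, F₂, F₃, F₄, F₅, F₆, F₇, h₁, h₂, h₃, h₄, -, -, -, H⟩ := hgen
  have lift : ∀ {F : M → ℝ}, CMDiff ∞ F → ∃ G : SmoothFn E M, ⇑G = F := fun h ↦ ⟨⟨_, h⟩, rfl⟩
  obtain ⟨F₁, rfl⟩ := lift h₁
  obtain ⟨F₂, rfl⟩ := lift h₂
  obtain ⟨F₃, rfl⟩ := lift h₃
  obtain ⟨F₄, rfl⟩ := lift h₄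
  set L := fContactAlgebra S hS
  have hη : ∀ {X : SmoothVF E M}, L.IsHor X → ∀ α x, S.ηApply α X x = 0 := fun hX α x ↦ by
    rw [fContactAlgebra_η hS]; exact DFunLike.congr_fun (hX α) x
  constructor
  · refine ⟨F₁, F₂, fun X Y Z hX hY hZ ↦ ?_⟩
    ext x
    have h := H X Y Z X.contMDiff Y.contMDiff Z.contMDiff x
    simp only [hη hX, hη hY, hη hZ] at h
    rw [fContactAlgebra_Rm, h]
    simp only [mul_zero, zero_smul, sub_zero, add_zero, smul_zero]
    simp only [SmoothVF.add_apply, SmoothVF.smul_apply, SmoothVF.sub_apply, SmoothFn.mul_apply,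
      SmoothFn.two_apply]
    rfl
  -- With $X$ horizontal and both other arguments $\xi_\alpha$, only $F_1$ and the diagonal term
  -- $F_3$ (for $\xi_1$) or $F_4$ (for $\xi_2$) contribute.
  · refine ⟨![F₁ - F₃, F₁ - F₄], fun α X hX ↦ ?_⟩
    ext x
    have h := H X (L.ξ α) (L.ξ α) X.contMDiff (L.ξ α).contMDiff (L.ξ α).contMDiff x
    have e1 : pair S.g (L.ξ α) (L.ξ α) x = 1 := by
      have := DFunLike.congr_fun (L.ξ_ξ α α) x
      simpa using! this
    have e2 : pair S.g X (L.ξ α) x = 0 := by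
      rw [pair_comm]; exact DFunLike.congr_fun (hX α) x
    have e3 : S.fApply (L.ξ α) = 0 := funext fun x ↦ S.f_ξ α x
    have e4 : ∀ Y, pair S.g Y 0 x = 0 := fun Y ↦ by simp [pair]
    have e5 : ∀ β, S.ηApply β (L.ξ α) x = if β = α then 1 else 0 := fun β ↦ S.η_ξ β α x
    simp only [hη hX, e1, e2, e3, e4, e5] at h
    rw [fContactAlgebra_Rm, h]
    fin_cases α <;> simp [sub_eq_add_neg] <;> module

lemma nullity (hgen : S.IsGeneralizedSSpaceForm) {κ μ : ℝ} (hnull : S.IsFKappaMu κ μ) :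
    (fContactAlgebra S hS).Nullity (algebraMap ℝ _ κ) := by
  obtain ⟨-, c, hc⟩ := exists_horizontal_form hS hgen
  -- The coefficient is $\mu/2$ because $h_\alpha=\frac12L_{\xi_\alpha}f$.
  refine FContactAlgebra.nullity_of_scalar (m := algebraMap ℝ _ (μ / 2)) (fun α X Y ↦ ?_) c hc
  ext x
  have h := hnull.2 α X Y X.contMDiff Y.contMDiff x
  rw [fContactAlgebra_ηb hS, fContactAlgebra_ηb hS, fContactAlgebra_h hS,
    fContactAlgebra_h hS] at h
  rw [fContactAlgebra_Rm]
  refine h.trans ?_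
  simp only [SmoothVF.add_apply, SmoothVF.smul_apply, SmoothVF.sub_apply,
    SmoothFn.algebraMap_apply]
  change _ = κ • (_ • S.fApply (S.fApply Y) x - _ • S.fApply (S.fApply X) x) + _
  module

/-- Finitely many covectors have a common zero in large dimension. -/
lemma exists_common_zero {E : Type*} [NormedAddCommGroup E] [NormedSpace ℝ E]
    [FiniteDimensional ℝ E] {M : Type*} [TopologicalSpace M] [ChartedSpace E M] {x : M} {m : ℕ}
    (hm : m < Module.finrank ℝ E)
    (φ : Fin m → TangentSpace 𝓘(ℝ, E) x →L[ℝ] ℝ) :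
    ∃ v : TangentSpace 𝓘(ℝ, E) x, v ≠ 0 ∧ ∀ i, φ i v = 0 := by
  have : FiniteDimensional ℝ (TangentSpace 𝓘(ℝ, E) x) := inferInstanceAs (FiniteDimensional ℝ E)
  let Φ : TangentSpace 𝓘(ℝ, E) x →ₗ[ℝ] (Fin m → ℝ) := LinearMap.pi fun i ↦ (φ i).toLinearMap
  have hr : Module.finrank ℝ (Fin m → ℝ) < Module.finrank ℝ (TangentSpace 𝓘(ℝ, E) x) := by
    rw [Module.finrank_fin_fun]; exact hm
  obtain ⟨v, hv, hv0⟩ := Submodule.exists_mem_ne_zero_of_ne_bot (Φ.ker_ne_bot_of_finrank_lt hr)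
  exact ⟨v, hv0, fun i ↦ congrFun (LinearMap.mem_ker.1 hv) i⟩

/-- A horizontal field, non-zero at `x` and annihilated there by two given covectors. -/
lemma exists_isHor (hn : 1 < n) (hdim : Module.finrank ℝ E = 2 * n + 2) {x : M}
    (φ ψ : TangentSpace 𝓘(ℝ, E) x →L[ℝ] ℝ) :
    ∃ X : SmoothVF E M, (fContactAlgebra S hS).IsHor X ∧ X x ≠ 0 ∧ φ (X x) = 0 ∧ ψ (X x) = 0 := by
  obtain ⟨v, hv, h⟩ := exists_common_zero (x := x) (m := 4) (by omega) ![S.η 0 x, S.η 1 x, φ, ψ]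
  obtain ⟨Z, hZ, rfl⟩ := exists_extension v
  -- The operator $-f^2$ is the horizontal projection: it makes the extension horizontal everywhere
  -- and leaves its value at `x` unchanged.
  have e : (- (fContactAlgebra S hS).f ((fContactAlgebra S hS).f ⟨Z, hZ⟩) : SmoothVF E M) x
      = Z x := by
    change - S.f x (S.f x (Z x)) = Z x
    rw [S.f_sq, Fin.sum_univ_two]
    have h0 : S.η 0 x (Z x) = 0 := h 0
    have h1 : S.η 1 x (Z x) = 0 := h 1
    simp [h0, h1]
  refine ⟨_, FContactAlgebra.isHor_neg_f_f ⟨Z, hZ⟩, ?_⟩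
  rw [e]
  exact ⟨hv, h 2, h 3⟩

/-- A generalized `S`-space-form of dimension at least `6` that is an `f`-`(κ, μ)` manifold has
`κ = 1`. -/
lemma kappa_eq_one (hn : 1 < n) (hdim : Module.finrank ℝ E = 2 * n + 2)
    (hgen : S.IsGeneralizedSSpaceForm) {κ μ : ℝ} (hnull : S.IsFKappaMu κ μ) (x : M) : κ = 1 := by
  have hS := hnull.1
  have hk := nullity hS hgen hnull
  obtain ⟨⟨F₁, F₂, hF⟩, -⟩ := exists_horizontal_form hS hgen
  set L := fContactAlgebra S hS with hL
  by_contra hne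
  obtain ⟨X, hX, hX0, -⟩ := exists_isHor hS hn hdim (x := x) 0 0
  -- Positivity of $g$ in $\|B_0X\|^2=(1-\kappa)\|X\|^2$ excludes $\kappa>1$.
  have hle : κ < 1 := by
    refine lt_of_le_of_ne (le_of_not_gt fun hgt ↦ ?_) hne
    have h1 := DFunLike.congr_fun (hk.g_B_B 0 X) x
    rw [← neg_neg (L.g (L.f X) (L.f X)), ← L.f_skew, hX.f_sq] at h1
    have h2 : 0 ≤ L.g (L.B 0 X) (L.B 0 X) x := by
      by_cases h : L.B 0 X x = 0
      · rw [fContactAlgebra_g, h]; simp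
      · exact (S.g.pos x _ h).le
    have h3 : 0 < L.g X X x := S.g.pos x _ hX0
    simp at h1
    nlinarith
  have hl0 : 0 < √(1 - κ) := Real.sqrt_pos.2 (by linarith)
  have hunit : ∀ {c : ℝ}, c ≠ 0 → IsUnit (algebraMap ℝ (SmoothFn E M) c) := fun hc ↦
    (IsUnit.mk0 _ hc).map _
  set l := algebraMap ℝ (SmoothFn E M) √(1 - κ) with hldef
  have hl : IsUnit l := hunit hl0.ne'
  have hl1 : IsUnit (1 + l) := by
    rw [hldef, ← map_one (algebraMap ℝ (SmoothFn E M)), ← map_add]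
    exact hunit (by positivity)
  have hkl : l * l = 1 - algebraMap ℝ (SmoothFn E M) κ := by
    rw [hldef, ← map_mul, Real.mul_self_sqrt (by linarith), map_sub, map_one]
  have hD : ∀ X, L.D X l = 0 := fun X ↦ by
    ext y
    change d% (fun _ : M ↦ √(1 - κ)) y (X y) = 0
    rw [mvfderiv_const]; rfl
  have hsplit : ∀ {W : SmoothVF E M}, L.IsHor W → W x ≠ 0 → ∃ W₁ W₂, L.IsPlus l W₁ ∧
      L.IsPlus l W₂ ∧ W = W₁ + L.f W₂ ∧ (W₁ x ≠ 0 ∨ W₂ x ≠ 0) := fun hW hW0 ↦ by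
    obtain ⟨W₁, W₂, h1, h2, rfl⟩ := FContactAlgebra.exists_plus hk hl hkl hW
    refine ⟨W₁, W₂, h1, h2, rfl, ?_⟩
    by_contra! h
    apply hW0
    rw [SmoothVF.add_apply, h.1, fContactAlgebra_f, h.2]; simp
  obtain ⟨P, hP, hP0⟩ : ∃ P, L.IsPlus l P ∧ P x ≠ 0 := by
    obtain ⟨X₁, X₂, h1, h2, -, h | h⟩ := hsplit hX hX0
    exacts [⟨X₁, h1, h⟩, ⟨X₂, h2, h⟩]
  -- Choosing $W$ orthogonal at `x` to both $P$ and $fP$ makes both parts of $W=W_1+fW_2$ yield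
  -- eigenfields orthogonal to $P$ there; at least one is nonzero at `x`.
  obtain ⟨W, hW, hW0, hWP, hWfP⟩ := exists_isHor hS hn hdim
    (S.g.inner x (P x)) (S.g.inner x (S.f x (P x)))
  obtain ⟨Q, hQ, hQ0, hQP⟩ : ∃ Q, L.IsPlus l Q ∧ Q x ≠ 0 ∧ L.g P Q x = 0 := by
    obtain ⟨W₁, W₂, h1, h2, e, h⟩ := hsplit hW hW0
    have p1 : L.g P W = L.g P W₁ := by rw [e, map_add, hP.g_f hk hl h2, add_zero]
    have p2 : L.g (L.f P) W = L.g P W₂ := by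
      rw [e, map_add, hP.g_f_f, L.f_skew, hP.g_f hk hl h1]; simp
    rcases h with h | h
    · exact ⟨W₁, h1, h, by rw [← p1]; exact hWP⟩
    · exact ⟨W₂, h2, h, by rw [← p2]; exact hWfP⟩
  have hG := DFunLike.congr_fun (hk.gram_eq_zero hl hl1 hD hkl hF hP hQ) x
  simp only [SmoothFn.sub_apply, SmoothFn.mul_apply, hQP, mul_zero, sub_zero,
    SmoothFn.zero_apply] at hG
  have h1 : 0 < L.g P P x := S.g.pos x _ hP0
  have h2 : 0 < L.g Q Q x := S.g.pos x _ hQ0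
  exact (mul_pos h1 h2).ne' hG

/-- A generalized `S`-space-form of dimension at least `6` that is an `f`-`(κ, μ)` manifold is
normal. -/
lemma isNormal (hn : 1 < n) (hdim : Module.finrank ℝ E = 2 * n + 2)
    (hgen : S.IsGeneralizedSSpaceForm) {κ μ : ℝ} (hnull : S.IsFKappaMu κ μ) : S.IsNormal := by
  intro X Y hX hY x
  have hS := hnull.1
  have hk := nullity hS hgen hnull
  obtain rfl := kappa_eq_one hn hdim hgen hnull x
  set L := fContactAlgebra S hS with hL
  have hB : ∀ α, L.B α = 0 := fun α ↦ by
    ext Z y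
    have h := DFunLike.congr_fun (hk.g_B_B α Z) y
    rw [map_one, sub_self, zero_mul] at h
    by_contra hne
    exact (S.g.pos y _ hne).ne' h
  have h := DFunLike.congr_fun (hk.normal hB ⟨X, hX⟩ ⟨Y, hY⟩) x
  simp only [hL, fContactAlgebra_brk] at h
  rw [Fin.sum_univ_two, ← hS 0 X Y hX hY, ← hS 1 X Y hX hY]
  simp only [SmoothVF.add_apply, SmoothVF.smul_apply, SmoothVF.sub_apply, SmoothFn.two_apply] at h
  exact h

end SpaceForms
end FGeom

theorem mainTheorem3
    {E : Type*} [NormedAddCommGroup E] [NormedSpace ℝ E] [FiniteDimensional ℝ E]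
    {M : Type*} [TopologicalSpace M] [T2Space M] [SecondCountableTopology M]
    [ChartedSpace E M] [IsManifold 𝓘(ℝ, E) ∞ M]
    (n : ℕ) (hn : 1 < n) (hdim : Module.finrank ℝ E = 2 * n + 2)
    (S : FGeom.MetricFStructure E M n 2) (κ μ : ℝ)
    (hgen : S.IsGeneralizedSSpaceForm) (hnull : S.IsFKappaMu κ μ) :
    S.IsFKappaMuSpaceForm κ μ ↔ (S.IsSSpaceForm ∨ (κ = -1 ∧ μ = 0)) := by
  constructor
  · rintro ⟨-, hc⟩
    exact Or.inl ⟨⟨hnull.1, FGeom.isNormal hn hdim hgen hnull⟩, hc⟩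
  · rintro (h | ⟨rfl, -⟩)
    · exact ⟨hnull, h.2⟩
    -- Any point `x` forces $\kappa=1$, contradicting $\kappa=-1$; so the constant $0$ is arbitrary.
    · refine ⟨hnull, 0, fun X _ x ↦ ?_⟩
      have := FGeom.kappa_eq_one hn hdim hgen hnull x
      norm_num at this
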